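/- Let $\mathbb F$ be a field of characteristic zero, let $\gamma, s \in \mathbb F^\times$ with $s$ not a root of unity, let $f \in \mathbb F[h]$, and let $l, m, n \in \mathbb Z$ with $l \neq 0$. For a field $k$, a $k$-algebra $H$, a $k$-algebra map $\theta : H \to H$ and $z_0, z_1 \in H$, let $$\mathcal W(H,\theta,z_0,z_1) := H\langle d,u\rangle / (uh = \theta(h)u,\ hd = d\,\theta(h),\ ud = z_0 + d z_1 u\ \ \forall h \in H).$$ For a weight $\mu : H \to k$ (a $k$-algebra map), the Verma module over $A = \mathcal W(H,\theta,z_0,z_1)$ is $M(\mu) = A/(Au + A\ker\mu)$; a highest weight module of highest weight $\mu$ is a nonzero quotient of $M(\mu)$. The $\mu$-weight space of an $A$-module $M$ is $M_\mu = \{x \in M : hx = \mu(h)x\ \forall h \in H\}$, and the formal character is $\mathrm{ch}\, M = \sum_\mu (\dim_k M_\mu)\, e^\mu$. Let $q$ be an indeterminate, let $R \subset \mathbb F(q)$ be the ring of rational functions regular at $q = 1$, put $H_q = \mathbb F(q)[K^{\pm1}]$, let $\theta_q$ be the $\mathbb F(q)$-algebra automorphism $K \mapsto q^{-l}K$ of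 $H_q$, put $(K;0)_q = \frac{K-1}{q-1}$, and let $$\mathcal W_q = \mathcal W_q(l,m,n) := \mathcal W\Bigl(H_q,\ \theta_q,\ s^{-1} q^m K^n f\bigl(-\tfrac{\gamma}{l}(K;0)_q\bigr),\ s^{-1}\Bigr),$$ with generators $U, D$ (in the roles of $u, d$) over $H_q$. Let $\mathcal W_q^R$ be the unital $R$-subalgebra of $\mathcal W_q$ generated by $U, D, K^{\pm1}, (K;0)_q$. Let $\theta$ be the automorphism $h \mapsto h+\gamma$ of $\mathbb F[h]$, and let $\mathcal W := \mathcal W(\mathbb F[h], \theta, s^{-1}f, s^{-1})$, a generalized down-up algebra. (1) There is an isomorphism of $\mathbb F$-algebras $$\mathcal W \;\cong\; \mathcal W_1 := \mathcal W_q^R/(q-1)\mathcal W_q^R$$ sending $u, d, h$ to the classes of $U, D, -\frac{\gamma}{l}(K;0)_q$ respectively. (2) Let $\lambda \in \mathbb F(q)^\times$ with $\frac{\lambda-1}{q-1} \in R$, let $V$ be a highest weight module over $\mathcal W_q$ whose highest weight is $K \mapsto \lambda$ (also denoted $\lambda$), and let $v \in V_\lambda$ generate $V$ over $\mathcal W_q$.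 Then $V_1 := \mathcal W_q^R v/(q-1)\mathcal W_q^R v$, regarded as a $\mathcal W$-module through the isomorphism in (1), is a highest weight module whose highest weight is $$\lambda_1 : h \mapsto -\frac{\gamma}{l}\cdot\frac{\lambda-1}{q-1}\Big|_{q=1},$$ and it has the same graded character as $V$, up to the change of highest weight: there are multiplicities $c_k$, $k \geq 0$, such that $$\mathrm{ch}\, V = \sum_{k\geq0} c_k\, e^{\lambda\circ\theta_q^k} \qquad\text{and}\qquad \mathrm{ch}\, V_1 = \sum_{k\geq0} c_k\, e^{\lambda_1\circ\theta^k}.$$ -/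

import Mathlib

open scoped Polynomial LaurentPolynomial

universe u v w

noncomputable section

/-! ### Triangular generalized Weyl algebras -/

/-- The data defining a triangular generalized Weyl algebra over the `F`-algebra `H`:
an `F`-algebra map `θ : H → H` and two elements `z₀, z₁ ∈ H`. -/
structure GWAData (F : Type u) (H : Type v) [Field F] [Ring H] [Algebra F H] where
  /-- The twisting map. -/
  θ : H →ₐ[F] H
  /-- The element `z₀`. -/
  z₀ : H
  /-- The element `z₁`. -/
  z₁ : H

/-- The generators of `H⟨d, u⟩`: the elements of `H`, and two further letters `d`, `u`. -/
inductive GWAGen (H : Type v) : Type v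
  | coeff (h : H) : GWAGen H
  | d : GWAGen H
  | u : GWAGen H

section GWA

variable {F : Type u} {H : Type v} [Field F] [Ring H] [Algebra F H]

/-- The defining relations of the triangular generalized Weyl algebra. The first three say that
`H` maps to the quotient by a homomorphism of unital `F`-algebras, the last three are
`u h = θ(h) u`, `h d = d θ(h)` and `u d = z₀ + d z₁ u`. -/
inductive GWARel (𝒟 : GWAData F H) :
    FreeAlgebra F (GWAGen H) → FreeAlgebra F (GWAGen H) → Prop
  | add (a b : H) : GWARel 𝒟 (FreeAlgebra.ι F (.coeff (a + b)))
      (FreeAlgebra.ι F (.coeff a) + FreeAlgebra.ι F (.coeff b))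
  | mul (a b : H) : GWARel 𝒟 (FreeAlgebra.ι F (.coeff (a * b)))
      (FreeAlgebra.ι F (.coeff a) * FreeAlgebra.ι F (.coeff b))
  | scalar (c : F) : GWARel 𝒟 (FreeAlgebra.ι F (.coeff (algebraMap F H c)))
      (algebraMap F (FreeAlgebra F (GWAGen H)) c)
  | u_coeff (h : H) : GWARel 𝒟 (FreeAlgebra.ι F .u * FreeAlgebra.ι F (.coeff h))
      (FreeAlgebra.ι F (.coeff (𝒟.θ h)) * FreeAlgebra.ι F .u)
  | coeff_d (h : H) : GWARel 𝒟 (FreeAlgebra.ι F (.coeff h) * FreeAlgebra.ι F .d)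
      (FreeAlgebra.ι F .d * FreeAlgebra.ι F (.coeff (𝒟.θ h)))
  | u_d : GWARel 𝒟 (FreeAlgebra.ι F .u * FreeAlgebra.ι F .d)
      (FreeAlgebra.ι F (.coeff 𝒟.z₀) +
        FreeAlgebra.ι F .d * FreeAlgebra.ι F (.coeff 𝒟.z₁) * FreeAlgebra.ι F .u)

/-- The triangular generalized Weyl algebra
`𝓦(H, θ, z₀, z₁) = H⟨d, u⟩ / (u h = θ(h) u, h d = d θ(h), u d = z₀ + d z₁ u)`. -/
def TriangularGWA (𝒟 : GWAData F H) : Type (max u v) :=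
  RingQuot (GWARel 𝒟)

namespace TriangularGWA

variable (𝒟 : GWAData F H)

instance : Ring (TriangularGWA 𝒟) := inferInstanceAs (Ring (RingQuot (GWARel 𝒟)))

instance : Algebra F (TriangularGWA 𝒟) := inferInstanceAs (Algebra F (RingQuot (GWARel 𝒟)))

/-- The image of a generator. -/
def gen (g : GWAGen H) : TriangularGWA 𝒟 :=
  RingQuot.mkAlgHom F (GWARel 𝒟) (FreeAlgebra.ι F g)

/-- The lowering operator `d`. -/
def d : TriangularGWA 𝒟 := gen 𝒟 .d

/-- The raising operator `u`. -/
def u : TriangularGWA 𝒟 := gen 𝒟 .u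

/-- The structure map `H → 𝓦(H, θ, z₀, z₁)`. -/
def coeff : H →ₐ[F] TriangularGWA 𝒟 :=
  AlgHom.ofLinearMap
    { toFun := fun h => gen 𝒟 (.coeff h)
      map_add' := fun a b =>
        (RingQuot.mkAlgHom_rel F (GWARel.add (𝒟 := 𝒟) a b)).trans (map_add _ _ _)
      map_smul' := fun c a => by
        rw [Algebra.smul_def]
        refine ((RingQuot.mkAlgHom_rel F
          (GWARel.mul (𝒟 := 𝒟) (algebraMap F H c) a)).trans (map_mul _ _ _)).trans ?_
        rw [RingQuot.mkAlgHom_rel F (GWARel.scalar (𝒟 := 𝒟) c),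
          AlgHom.commutes, ← Algebra.smul_def]
        rfl }
    (by
      have h := RingQuot.mkAlgHom_rel F (GWARel.scalar (𝒟 := 𝒟) 1)
      rw [map_one, map_one, map_one] at h
      exact h)
    (fun a b =>
      (RingQuot.mkAlgHom_rel F (GWARel.mul (𝒟 := 𝒟) a b)).trans (map_mul _ _ _))

/-! ### Weights, Verma modules, highest weight modules, characters -/

section Modules

variable (M : Type w) [AddCommGroup M] [Module (TriangularGWA 𝒟) M]

variable {M} in
/-- `m` lies in the `μ`-weight space: `h m = μ(h) m` for all `h ∈ H`. -/
def IsWeightVector (μ : H →ₐ[F] F) (m : M) : Prop :=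
  ∀ h : H, coeff 𝒟 h • m = algebraMap F (TriangularGWA 𝒟) (μ h) • m

/-- The `μ`-weight space of a module, as an `F`-subspace. -/
def weightSpace (μ : H →ₐ[F] F) :
    Submodule F (RestrictScalars F (TriangularGWA 𝒟) M) where
  carrier := {m | IsWeightVector 𝒟 (M := M) μ m}
  zero_mem' := fun h =>
    (smul_zero (A := M) (coeff 𝒟 h)).trans (smul_zero (A := M) _).symm
  add_mem' := fun {a b} ha hb h =>
    (smul_add (A := M) (coeff 𝒟 h) a b).trans
      ((congrArg₂ (fun x y : M => x + y) (ha h) (hb h)).trans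
        (smul_add (A := M) (algebraMap F (TriangularGWA 𝒟) (μ h)) a b).symm)
  smul_mem' := fun c (a : M) ha h => by
    have key : coeff 𝒟 h • (algebraMap F (TriangularGWA 𝒟) c • a) =
        algebraMap F (TriangularGWA 𝒟) (μ h) • (algebraMap F (TriangularGWA 𝒟) c • a) := by
      have hc : coeff 𝒟 h • a = algebraMap F (TriangularGWA 𝒟) (μ h) • a := ha h
      rw [smul_smul, ← Algebra.commutes, ← smul_smul, hc, smul_smul, smul_smul,
        Algebra.commutes]
    exact key

/-- The formal character `∑_μ (dim M_μ) e^μ`, as the function `μ ↦ dim M_μ`. -/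
def formalCharacter (μ : H →ₐ[F] F) : Cardinal.{w} :=
  Module.rank F (weightSpace 𝒟 M μ)

end Modules

/-- The left ideal `A u + A ker μ` of `A = 𝓦(H, θ, z₀, z₁)`. -/
def vermaIdeal (μ : H →ₐ[F] F) : Ideal (TriangularGWA 𝒟) :=
  Ideal.span (insert (u 𝒟) (coeff 𝒟 '' {h | μ h = 0}))

/-- The Verma module `M(μ) = A / (A u + A ker μ)` over `A = 𝓦(H, θ, z₀, z₁)`. -/
def Verma (μ : H →ₐ[F] F) : Type (max u v) :=
  TriangularGWA 𝒟 ⧸ vermaIdeal 𝒟 μ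

instance (μ : H →ₐ[F] F) : AddCommGroup (Verma 𝒟 μ) :=
  Submodule.Quotient.addCommGroup (vermaIdeal 𝒟 μ)

instance (μ : H →ₐ[F] F) : Module (TriangularGWA 𝒟) (Verma 𝒟 μ) :=
  Submodule.Quotient.module (vermaIdeal 𝒟 μ)

/-- `M` is a highest weight module of highest weight `μ`: a nonzero quotient of `M(μ)`. -/
def IsHighestWeightModule (μ : H →ₐ[F] F) (M : Type w) [AddCommGroup M]
    [Module (TriangularGWA 𝒟) M] : Prop :=
  Nontrivial M ∧ ∃ π : Verma 𝒟 μ →ₗ[TriangularGWA 𝒟] M, Function.Surjective π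

/-- The modules `M` and `M'`, over two triangular generalized Weyl algebras, have the same
graded character relative to the highest weights `μ` and `μ'`: there are multiplicities `c_k`
such that `ch M = ∑_k c_k e^{μ ∘ θ^k}` and `ch M' = ∑_k c_k e^{μ' ∘ θ'^k}`, where `k` runs
over the natural numbers. -/
def SameGradedCharacter {F' : Type u} {H' : Type v} [Field F'] [Ring H'] [Algebra F' H']
    (𝒟' : GWAData F' H') (μ : H →ₐ[F] F) (M : Type w) [AddCommGroup M]
    [Module (TriangularGWA 𝒟) M] (μ' : H' →ₐ[F'] F') (M' : Type w) [AddCommGroup M']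
    [Module (TriangularGWA 𝒟') M'] : Prop :=
  (∀ k : ℕ, formalCharacter 𝒟 M (μ.comp (𝒟.θ ^ k)) =
    formalCharacter 𝒟' M' (μ'.comp (𝒟'.θ ^ k))) ∧
  (∀ ν : H →ₐ[F] F, formalCharacter 𝒟 M ν ≠ 0 → ∃ k : ℕ, ν = μ.comp (𝒟.θ ^ k)) ∧
  (∀ ν : H' →ₐ[F'] F', formalCharacter 𝒟' M' ν ≠ 0 → ∃ k : ℕ, ν = μ'.comp (𝒟'.θ ^ k))

end TriangularGWA

end GWA

/-- A `B`-module regarded as an `A`-module along a ring homomorphism `φ : A → B`. -/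
def PullbackModule {A : Type u} {B : Type v} [Ring A] [Ring B] (_φ : A →+* B) (M : Type w) :
    Type w := M

namespace PullbackModule

variable {A : Type u} {B : Type v} [Ring A] [Ring B] (φ : A →+* B) (M : Type w) [AddCommGroup M]

instance : AddCommGroup (PullbackModule φ M) := inferInstanceAs (AddCommGroup M)

instance [Module B M] : Module A (PullbackModule φ M) := Module.compHom M φ

end PullbackModule

/-! ### The quantum algebras and the local ring at `q = 1` -/

section Quantum

variable (F : Type u) [Field F]

/-- The subring `R ⊆ F(q)` of rational functions that are regular at `q = 1`. -/
def regularAtOne : Subalgebra F (RatFunc F) where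
  carrier := {x | x.denom.eval 1 ≠ 0}
  mul_mem' := fun {x y} hx hy h => by
    have h1 := Polynomial.eval_dvd (x := (1 : F)) (RatFunc.denom_mul_dvd x y)
    rw [h, zero_dvd_iff, Polynomial.eval_mul] at h1
    exact mul_ne_zero hx hy h1
  add_mem' := fun {x y} hx hy h => by
    have h1 := Polynomial.eval_dvd (x := (1 : F)) (RatFunc.denom_add_dvd x y)
    rw [h, zero_dvd_iff, Polynomial.eval_mul] at h1
    exact mul_ne_zero hx hy h1
  algebraMap_mem' := fun c => by
    have h : (algebraMap F (RatFunc F) c).denom = 1 := by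
      rw [RatFunc.algebraMap_eq_C, RatFunc.denom_C]
    change (algebraMap F (RatFunc F) c).denom.eval 1 ≠ 0
    rw [h, Polynomial.eval_one]
    exact one_ne_zero

/-- The element `q - 1` of `R`. -/
def qSubOne : regularAtOne F :=
  ⟨RatFunc.X - 1, by
    have h : (RatFunc.X - 1 : RatFunc F) = algebraMap F[X] (RatFunc F) (Polynomial.X - 1) := by
      simp
    change (RatFunc.X - 1 : RatFunc F).denom.eval 1 ≠ 0
    rw [h, RatFunc.denom_algebraMap]
    simp⟩

/-- The `k`-algebra homomorphism `k[K, K⁻¹] → A` that sends `K` to the unit `x`. -/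
def laurentLift {k : Type u} {A : Type v} [Field k] [CommRing A] [Algebra k A] (x : Aˣ) :
    k[T;T⁻¹] →ₐ[k] A :=
  { LaurentPolynomial.eval₂ (algebraMap k A) x with
    commutes' := fun r => LaurentPolynomial.eval₂_C _ _ r }

/-- The unit `q⁻ˡ K` of `H_q = F(q)[K, K⁻¹]`. -/
def qShiftK (l : ℤ) : ((RatFunc F)[T;T⁻¹])ˣ where
  val := LaurentPolynomial.C ((RatFunc.X : RatFunc F) ^ (-l)) * LaurentPolynomial.T 1
  inv := LaurentPolynomial.C ((RatFunc.X : RatFunc F) ^ l) * LaurentPolynomial.T (-1)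
  val_inv := by
    rw [mul_mul_mul_comm, ← map_mul, ← zpow_add₀ RatFunc.X_ne_zero, ← LaurentPolynomial.T_add]
    simp
  inv_val := by
    rw [mul_mul_mul_comm, ← map_mul, ← zpow_add₀ RatFunc.X_ne_zero, ← LaurentPolynomial.T_add]
    simp

/-- `(K; 0)_q = (K - 1) / (q - 1)` in `H_q`. -/
def quantumK0 : (RatFunc F)[T;T⁻¹] :=
  LaurentPolynomial.C ((RatFunc.X - 1 : RatFunc F)⁻¹) * (LaurentPolynomial.T 1 - 1)

variable {F}

/-- The data of the quantum triangular generalized Weyl algebra `𝓦_q(l, m, n)` over `F(q)`: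
`H_q = F(q)[K, K⁻¹]`, `θ : K ↦ q⁻ˡ K`, `z₀ = s⁻¹ qᵐ Kⁿ f(-(γ / l) (K; 0)_q)`, `z₁ = s⁻¹`. -/
def quantumData (γ s : F) (f : F[X]) (l m n : ℤ) : GWAData (RatFunc F) ((RatFunc F)[T;T⁻¹]) where
  θ := laurentLift (qShiftK F l)
  z₀ := LaurentPolynomial.C (RatFunc.C s⁻¹ * RatFunc.X ^ m) * LaurentPolynomial.T n *
    Polynomial.aeval (LaurentPolynomial.C (RatFunc.C (-γ / (l : F))) * quantumK0 F) f
  z₁ := LaurentPolynomial.C (RatFunc.C s⁻¹)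

/-- The data of the generalized down-up algebra `𝓦(F[h], h ↦ h + γ, s⁻¹ f, s⁻¹)`. -/
def downUpData (γ s : F) (f : F[X]) : GWAData F F[X] where
  θ := Polynomial.aeval (Polynomial.X + Polynomial.C γ)
  z₀ := Polynomial.C s⁻¹ * f
  z₁ := Polynomial.C s⁻¹

/-- The quantum triangular generalized Weyl algebra `𝓦_q(l, m, n)`. -/
abbrev QuantumGWA (γ s : F) (f : F[X]) (l m n : ℤ) : Type u :=
  TriangularGWA (quantumData γ s f l m n)

/-- The generalized down-up algebra `𝓦(F[h], h ↦ h + γ, s⁻¹ f, s⁻¹)`. -/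
abbrev DownUpAlgebra (γ s : F) (f : F[X]) : Type u :=
  TriangularGWA (downUpData γ s f)

namespace QuantumGWA

variable (γ s : F) (f : F[X]) (l m n : ℤ)

/-- The structure map `H_q → 𝓦_q(l, m, n)`. -/
abbrev coeff : (RatFunc F)[T;T⁻¹] →ₐ[RatFunc F] QuantumGWA γ s f l m n :=
  TriangularGWA.coeff _

/-- The generator `U`. -/
abbrev U : QuantumGWA γ s f l m n := TriangularGWA.u _

/-- The generator `D`. -/
abbrev D : QuantumGWA γ s f l m n := TriangularGWA.d _

/-- The `R`-subalgebra `𝓦^R_q(l, m, n)` generated by `U`, `D`, `K`, `K⁻¹` and `(K; 0)_q`. -/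
def rSubalgebra : Subalgebra (regularAtOne F) (QuantumGWA γ s f l m n) :=
  Algebra.adjoin (regularAtOne F)
    {U γ s f l m n, D γ s f l m n, coeff γ s f l m n (LaurentPolynomial.T 1),
      coeff γ s f l m n (LaurentPolynomial.T (-1)), coeff γ s f l m n (quantumK0 F)}

/-- The underlying type of `𝓦^R_q(l, m, n)`. -/
def RForm : Type u := rSubalgebra γ s f l m n

instance : Ring (RForm γ s f l m n) := inferInstanceAs (Ring (rSubalgebra γ s f l m n))

instance : Algebra (regularAtOne F) (RForm γ s f l m n) :=
  inferInstanceAs (Algebra (regularAtOne F) (rSubalgebra γ s f l m n))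

/-- The inclusion `𝓦^R_q(l, m, n) ⊆ 𝓦_q(l, m, n)`. -/
def RForm.incl : RForm γ s f l m n →+* QuantumGWA γ s f l m n :=
  ((rSubalgebra γ s f l m n).val : rSubalgebra γ s f l m n →+* QuantumGWA γ s f l m n)

/-- `U` as an element of the `R`-form. -/
def rU : RForm γ s f l m n :=
  (⟨U γ s f l m n, Algebra.subset_adjoin (by simp)⟩ : rSubalgebra γ s f l m n)

/-- `D` as an element of the `R`-form. -/
def rD : RForm γ s f l m n :=
  (⟨D γ s f l m n, Algebra.subset_adjoin (by simp)⟩ : rSubalgebra γ s f l m n)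

/-- `(K; 0)_q` as an element of the `R`-form. -/
def rK0 : RForm γ s f l m n :=
  (⟨coeff γ s f l m n (quantumK0 F), Algebra.subset_adjoin (by simp)⟩ : rSubalgebra γ s f l m n)

/-- The ideal `(q - 1) 𝓦^R_q(l, m, n)`. It is generated by a central element, so the left ideal
that this element generates is two-sided. -/
def limitIdeal : Ideal (RForm γ s f l m n) :=
  Ideal.span {algebraMap (regularAtOne F) (RForm γ s f l m n) (qSubOne F)}

instance : (limitIdeal γ s f l m n).IsTwoSided := by
  constructor
  intro a b ha
  obtain ⟨c, rfl⟩ := Ideal.mem_span_singleton'.mp ha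
  rw [mul_assoc, Algebra.commutes, ← mul_assoc]
  exact Ideal.mul_mem_left _ _ (Ideal.subset_span rfl)

/-- The classical limit `𝓦₁ = 𝓦^R_q(l, m, n) / (q - 1) 𝓦^R_q(l, m, n)`. -/
def ClassicalLimit : Type u := RForm γ s f l m n ⧸ limitIdeal γ s f l m n

instance : Ring (ClassicalLimit γ s f l m n) :=
  inferInstanceAs (Ring (RForm γ s f l m n ⧸ limitIdeal γ s f l m n))

/-- The quotient map `𝓦^R_q(l, m, n) → 𝓦₁`. -/
def toLimit : RForm γ s f l m n →+* ClassicalLimit γ s f l m n :=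
  Ideal.Quotient.mk (limitIdeal γ s f l m n)

/-- The `F`-algebra structure on `𝓦₁` given by `F → R → 𝓦^R_q(l, m, n) → 𝓦₁`. -/
instance : Algebra F (ClassicalLimit γ s f l m n) :=
  RingHom.toAlgebra' (((toLimit γ s f l m n).comp
      (algebraMap (regularAtOne F) (RForm γ s f l m n))).comp (algebraMap F (regularAtOne F)))
    (fun c x => by
      obtain ⟨y, rfl⟩ := Ideal.Quotient.mk_surjective (I := limitIdeal γ s f l m n) x
      change toLimit γ s f l m n (algebraMap (regularAtOne F) (RForm γ s f l m n)
          (algebraMap F (regularAtOne F) c)) * toLimit γ s f l m n y =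
        toLimit γ s f l m n y * toLimit γ s f l m n (algebraMap (regularAtOne F)
          (RForm γ s f l m n) (algebraMap F (regularAtOne F) c))
      rw [← map_mul, ← map_mul, Algebra.commutes])

section Modules

variable {V : Type w} [AddCommGroup V] [Module (QuantumGWA γ s f l m n) V] (v : V)

/-- The `R`-form `𝓦^R_q(l, m, n) v` of the module generated by `v`. -/
def moduleRForm :
    Submodule (RForm γ s f l m n) (PullbackModule (RForm.incl γ s f l m n) V) :=
  Submodule.span _ {(v : PullbackModule (RForm.incl γ s f l m n) V)}

/-- The submodule `(q - 1) 𝓦^R_q(l, m, n) v`. -/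
def moduleLimitSub : Submodule (RForm γ s f l m n) (moduleRForm γ s f l m n v) :=
  limitIdeal γ s f l m n • ⊤

/-- The classical limit `𝓦^R_q(l, m, n) v / (q - 1) 𝓦^R_q(l, m, n) v`. -/
def ModuleLimit : Type w :=
  moduleRForm γ s f l m n v ⧸ moduleLimitSub γ s f l m n v

instance : AddCommGroup (ModuleLimit γ s f l m n v) :=
  inferInstanceAs (AddCommGroup (moduleRForm γ s f l m n v ⧸ moduleLimitSub γ s f l m n v))

/-- The action of `𝓦₁` on the classical limit, induced by that of `𝓦^R_q(l, m, n)`. -/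
instance : Module (ClassicalLimit γ s f l m n) (ModuleLimit γ s f l m n v) :=
  inferInstanceAs (Module (RForm γ s f l m n ⧸ limitIdeal γ s f l m n)
    (moduleRForm γ s f l m n v ⧸ (limitIdeal γ s f l m n •
      (⊤ : Submodule (RForm γ s f l m n) (moduleRForm γ s f l m n v)))))

end Modules

end QuantumGWA

end Quantum

end

/-! ### Triangular generalized Weyl algebras: relations and universal property -/

namespace TriangularGWA

section General

variable {F : Type u} {H : Type v} [Field F] [Ring H] [Algebra F H] (𝒟 : GWAData F H)

/-! For (1), the relations of `𝓦` hold in `𝓦₁` because those of `𝓦_q` specialize. An element `r` of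
`R` acts on `𝓦₁` as `r(1)`, and `K = 1 + (q - 1)(K; 0)_q` has class `1`, so the factors `qᵐ` and
`Kⁿ` disappear. The twist sends `-(γ/l)(K; 0)_q` to `q⁻ˡ` times itself plus a scalar of value `γ` at
`q = 1`. The universal property then gives `limitHom`, which is surjective because all generators of
the `R`-form have classes in its image.

Injectivity replaces a basis theorem by a representation. The elements `dⁱ h uʲ` span `𝓦`
(`ordered_surjective`). If `∑ dⁱ P_ij(h) uʲ` dies in `𝓦₁`, the same expression in `𝓦_q`, with
`-(γ/l)(K; 0)_q` for `h`, equals `(q - 1) z` with `z` in the `R`-form. `𝓦_q` acts on a space with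
basis vectors `dⁱ uᵏ` (`ladder`), where the `(i, j)` coordinate of this expression applied to the
base vector is `P_ij` evaluated at a weight (`ladder_ordered_apply`). The `R`-form preserves the
`R`-lattice on this basis (`ladder_apply_mem`), so that value lies in `(q - 1)R` and vanishes at `q
= 1`. Varying the base weight makes `P_ij` vanish at every point of the infinite field `F`.

For (2), the weights `λ ∘ θ_qᵏ` are pairwise distinct, and so are their limits `λ₁ ∘ θᵏ`. Hence
every multiplicity is `0` or `1`, according to whether the `k`-th power of the lowering operator
kills the generator (`formalCharacter_comp_pow`). It remains to compare these vanishing conditions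
(`d_pow_smul_limitVector_eq_zero_iff`). The `R`-form of `V` is the `R`-span of the `Dᵏ v`. If `Dᵏ v`
lies in `q - 1` times this span, comparing weight components gives `(1 - (q - 1) r) Dᵏ v = 0` with
`r` in `R`. The scalar has value `1` at `q = 1`, so it is nonzero and `Dᵏ v = 0`. -/

theorem u_mul_coeff (h : H) : u 𝒟 * coeff 𝒟 h = coeff 𝒟 (𝒟.θ h) * u 𝒟 := by
  have := RingQuot.mkAlgHom_rel F (GWARel.u_coeff (𝒟 := 𝒟) h)
  rw [map_mul, map_mul] at this
  exact this

theorem coeff_mul_d (h : H) : coeff 𝒟 h * d 𝒟 = d 𝒟 * coeff 𝒟 (𝒟.θ h) := by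
  have := RingQuot.mkAlgHom_rel F (GWARel.coeff_d (𝒟 := 𝒟) h)
  rw [map_mul, map_mul] at this
  exact this

theorem u_mul_d : u 𝒟 * d 𝒟 = coeff 𝒟 𝒟.z₀ + d 𝒟 * coeff 𝒟 𝒟.z₁ * u 𝒟 := by
  have := RingQuot.mkAlgHom_rel F (GWARel.u_d (𝒟 := 𝒟))
  rw [map_mul, map_add, map_mul, map_mul] at this
  exact this

theorem coeff_mul_d_pow (h : H) (k : ℕ) :
    coeff 𝒟 h * d 𝒟 ^ k = d 𝒟 ^ k * coeff 𝒟 ((𝒟.θ ^ k) h) := by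
  induction k generalizing h with
  | zero => simp
  | succ k ih =>
    rw [pow_succ', ← mul_assoc, coeff_mul_d, mul_assoc, ih, ← mul_assoc, pow_succ]
    rfl

/-- The universal property of a triangular generalized Weyl algebra. -/
noncomputable def lift {B : Type w} [Ring B] [Algebra F B] (φ : H →ₐ[F] B) (d' u' : B)
    (hu : ∀ h, u' * φ h = φ (𝒟.θ h) * u') (hd : ∀ h, φ h * d' = d' * φ (𝒟.θ h))
    (hud : u' * d' = φ 𝒟.z₀ + d' * φ 𝒟.z₁ * u') : TriangularGWA 𝒟 →ₐ[F] B :=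
  RingQuot.liftAlgHom F ⟨FreeAlgebra.lift F fun g => match g with
    | .coeff h => φ h
    | .d => d'
    | .u => u', by
      rintro _ _ (⟨a, b⟩ | ⟨a, b⟩ | c | h | h | _)
      · simp
      · simp
      · simp
      · simpa using hu h
      · simpa using hd h
      · simpa using hud⟩

section Lift

variable {𝒟} {B : Type w} [Ring B] [Algebra F B] {φ : H →ₐ[F] B} {d' u' : B}
    (hu : ∀ h, u' * φ h = φ (𝒟.θ h) * u') (hd : ∀ h, φ h * d' = d' * φ (𝒟.θ h))
    (hud : u' * d' = φ 𝒟.z₀ + d' * φ 𝒟.z₁ * u')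

@[simp]
theorem lift_coeff (h : H) : lift 𝒟 φ d' u' hu hd hud (coeff 𝒟 h) = φ h := by
  change RingQuot.liftAlgHom F _ (RingQuot.mkAlgHom F _ _) = _
  rw [RingQuot.liftAlgHom_mkAlgHom_apply]
  simp

@[simp]
theorem lift_d : lift 𝒟 φ d' u' hu hd hud (d 𝒟) = d' := by
  change RingQuot.liftAlgHom F _ (RingQuot.mkAlgHom F _ _) = _
  rw [RingQuot.liftAlgHom_mkAlgHom_apply]
  simp

@[simp]
theorem lift_u : lift 𝒟 φ d' u' hu hd hud (u 𝒟) = u' := by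
  change RingQuot.liftAlgHom F _ (RingQuot.mkAlgHom F _ _) = _
  rw [RingQuot.liftAlgHom_mkAlgHom_apply]
  simp

end Lift

variable {𝒟} in
/-- An additive set stable under left multiplication by the generators is stable under left
multiplication by the whole algebra. -/
theorem smul_mem_of_generators {M : Type w} [AddCommGroup M] [Module (TriangularGWA 𝒟) M]
    (S : AddSubgroup M) (hc : ∀ h : H, ∀ x ∈ S, coeff 𝒟 h • x ∈ S)
    (hd : ∀ x ∈ S, d 𝒟 • x ∈ S) (hu : ∀ x ∈ S, u 𝒟 • x ∈ S) (a : TriangularGWA 𝒟) :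
    ∀ x ∈ S, a • x ∈ S := by
  let π : FreeAlgebra F (GWAGen H) →ₐ[F] TriangularGWA 𝒟 := RingQuot.mkAlgHom F (GWARel 𝒟)
  obtain ⟨a, rfl⟩ : ∃ b, π b = a := RingQuot.mkAlgHom_surjective F (GWARel 𝒟) a
  induction a using FreeAlgebra.induction with
  | grade0 r =>
    intro x hx
    -- Scalars act through `coeff`, which is why an additive subgroup is enough here.
    have h := hc (algebraMap F H r) x hx
    rw [AlgHom.commutes] at h
    rw [AlgHom.commutes]
    exact h
  | grade1 g =>
    rcases g with h | _ | _
    · exact hc h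
    · exact hd
    · exact hu
  | mul a b ha hb =>
    intro x hx
    rw [map_mul, mul_smul]
    exact ha _ (hb x hx)
  | add a b ha hb =>
    intro x hx
    rw [map_add, add_smul]
    exact S.add_mem (ha x hx) (hb x hx)

/-! ### Spanning by ordered monomials. -/

/-- The linear map `∑ (i, j, h) ↦ ∑ dⁱ h uʲ`. -/
noncomputable def ordered : (ℕ × ℕ →₀ H) →ₗ[F] TriangularGWA 𝒟 :=
  Finsupp.lsum F fun p : ℕ × ℕ =>
    LinearMap.mulLeft F (d 𝒟 ^ p.1) ∘ₗ LinearMap.mulRight F (u 𝒟 ^ p.2) ∘ₗ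
      (coeff 𝒟).toLinearMap

theorem ordered_single (p : ℕ × ℕ) (h : H) :
    ordered 𝒟 (Finsupp.single p h) = d 𝒟 ^ p.1 * (coeff 𝒟 h * u 𝒟 ^ p.2) := by
  simp [ordered]

theorem u_mul_d_pow (i : ℕ) : ∃ a b : H, u 𝒟 * d 𝒟 ^ (i + 1) =
    d 𝒟 ^ i * coeff 𝒟 a + d 𝒟 ^ (i + 1) * coeff 𝒟 b * u 𝒟 := by
  induction i with
  | zero => exact ⟨𝒟.z₀, 𝒟.z₁, by simpa using u_mul_d 𝒟⟩
  | succ i ih =>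
    obtain ⟨a, b, h⟩ := ih
    -- Expand the leftmost `u d` as `z₀ + d z₁ u`. The powers of `θ` come from moving `z₀` and `z₁`
    -- to the right past the remaining powers of `d`.
    refine ⟨(𝒟.θ ^ (i + 1)) 𝒟.z₀ + (𝒟.θ ^ i) 𝒟.z₁ * a, (𝒟.θ ^ (i + 1)) 𝒟.z₁ * b, ?_⟩
    rw [pow_succ' (d 𝒟) (i + 1), ← mul_assoc, u_mul_d, add_mul, coeff_mul_d_pow,
      mul_assoc _ (u 𝒟), h, mul_add, mul_assoc (d 𝒟), ← mul_assoc (coeff 𝒟 𝒟.z₁) (d 𝒟 ^ i),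
      mul_assoc (d 𝒟) (coeff 𝒟 𝒟.z₁), mul_assoc (d 𝒟 ^ (i + 1)) _ (u 𝒟),
      ← mul_assoc (coeff 𝒟 𝒟.z₁) (d 𝒟 ^ (i + 1)), coeff_mul_d_pow, coeff_mul_d_pow]
    simp only [map_add, map_mul, mul_add, pow_succ', mul_assoc, add_assoc]

/-- The range contains `1` and is stable under left multiplication by each generator. Only `u` needs
care: `u_mul_d_pow` moves it past `dⁱ`, and then `u h = θ(h) u` moves it past the coefficient. -/
theorem ordered_surjective : Function.Surjective (ordered 𝒟) := by
  set S := (LinearMap.range (ordered 𝒟)).toAddSubgroup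
  have key : ∀ a : TriangularGWA 𝒟, (∀ p h, a * ordered 𝒟 (Finsupp.single p h) ∈ S) →
      ∀ x ∈ S, a • x ∈ S := by
    rintro a ha _ ⟨P, rfl⟩
    induction P using Finsupp.induction_linear with
    | zero => rw [map_zero, smul_zero]; exact S.zero_mem
    | add P Q hP hQ => rw [map_add, smul_add]; exact S.add_mem hP hQ
    | single p h => exact ha p h
  have mem : ∀ i j h, d 𝒟 ^ i * (coeff 𝒟 h * u 𝒟 ^ j) ∈ S := fun i j h =>
    ⟨Finsupp.single (i, j) h, ordered_single 𝒟 (i, j) h⟩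
  intro a
  have h1 : (1 : TriangularGWA 𝒟) ∈ S := by simpa using mem 0 0 1
  have : a • (1 : TriangularGWA 𝒟) ∈ S := by
    refine smul_mem_of_generators S (fun h => key _ ?_) (key _ ?_) (key _ ?_) a 1 h1
    · rintro ⟨i, j⟩ h'
      rw [ordered_single, ← mul_assoc, coeff_mul_d_pow, mul_assoc, ← mul_assoc (coeff 𝒟 _),
        ← map_mul]
      exact mem _ _ _
    · rintro ⟨i, j⟩ h'
      rw [ordered_single, ← mul_assoc, ← pow_succ']
      exact mem _ _ _
    · rintro ⟨i, j⟩ h'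
      rw [ordered_single]
      rcases i with _ | i
      · have h2 := mem 0 (j + 1) (𝒟.θ h')
        rw [pow_succ', ← mul_assoc (coeff 𝒟 _), ← u_mul_coeff, mul_assoc, pow_zero,
          one_mul] at h2
        simpa using h2
      · obtain ⟨x, y, hxy⟩ := u_mul_d_pow 𝒟 i
        rw [← mul_assoc, hxy, add_mul, mul_assoc _ (coeff 𝒟 x), ← mul_assoc (coeff 𝒟 x),
          ← map_mul, mul_assoc _ (u 𝒟), ← mul_assoc (u 𝒟), u_mul_coeff, mul_assoc _ (u 𝒟),
          ← pow_succ', mul_assoc, ← mul_assoc (coeff 𝒟 y), ← map_mul]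
        exact S.add_mem (mem _ _ _) (mem _ _ _)
  rwa [smul_eq_mul, mul_one] at this

/-! ### The ladder representation -/

section Ladder

variable (χ : ℤ → H →ₐ[F] F)

/-- The coefficient of `dⁱ uᵏ⁺¹` in `u dⁱ uᵏ`. -/
def ladderRaise : ℕ → ℕ → F
  | 0, _ => 1
  | i + 1, k => χ (i - k - 1) 𝒟.z₁ * ladderRaise i k

/-- The coefficient of `dⁱ⁻¹ uᵏ` in `u dⁱ uᵏ`. -/
def ladderLower : ℕ → ℕ → F
  | 0, _ => 0
  | i + 1, k => χ (i - k) 𝒟.z₀ + χ (i - k - 1) 𝒟.z₁ * ladderLower i k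

/-- The operator `d` on the span of the `dⁱ uᵏ`. -/
noncomputable def ladderD (F : Type u) [Field F] : Module.End F (ℕ × ℕ →₀ F) :=
  Finsupp.linearCombination F fun p => Finsupp.single (p.1 + 1, p.2) 1

/-- The operator `u` on the span of the `dⁱ uᵏ`. -/
noncomputable def ladderU : Module.End F (ℕ × ℕ →₀ F) :=
  Finsupp.linearCombination F fun p =>
    ladderRaise 𝒟 χ p.1 p.2 • Finsupp.single (p.1, p.2 + 1) 1 +
      ladderLower 𝒟 χ p.1 p.2 • Finsupp.single (p.1 - 1, p.2) 1

/-- The action of `H` on the span of the `dⁱ uᵏ`. -/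
noncomputable def ladderCoeff : H →ₐ[F] Module.End F (ℕ × ℕ →₀ F) where
  toFun h := Finsupp.linearCombination F fun p => χ (p.1 - p.2) h • Finsupp.single p 1
  map_one' := by ext; simp
  map_zero' := by ext; simp
  map_add' a b := by
    refine Finsupp.lhom_ext fun p c => ?_
    simp [add_smul]
  map_mul' a b := by
    refine Finsupp.lhom_ext' fun p => LinearMap.ext_ring ?_
    simp [-Finsupp.smul_single, smul_smul, mul_comm]
  commutes' r := by
    refine Finsupp.lhom_ext fun p c => ?_
    simp [Module.algebraMap_end_apply, mul_comm]

theorem ladderD_single (i k : ℕ) :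
    ladderD F (Finsupp.single (i, k) 1) = Finsupp.single (i + 1, k) 1 := by
  simp [ladderD]

theorem ladderU_single (i k : ℕ) : ladderU 𝒟 χ (Finsupp.single (i, k) 1) =
    ladderRaise 𝒟 χ i k • Finsupp.single (i, k + 1) 1 +
      ladderLower 𝒟 χ i k • Finsupp.single (i - 1, k) 1 := by
  simp [ladderU]

theorem ladderCoeff_single (h : H) (i k : ℕ) : ladderCoeff χ h (Finsupp.single (i, k) 1) =
    χ (i - k) h • Finsupp.single (i, k) 1 := by
  simp [ladderCoeff]

variable {χ} (hχ : ∀ j, χ (j + 1) = (χ j).comp 𝒟.θ)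

/-- The representation on the span of the `dⁱ uᵏ`, that is, on `A / A ker (χ 0)`. -/
noncomputable def ladder : TriangularGWA 𝒟 →ₐ[F] Module.End F (ℕ × ℕ →₀ F) :=
  lift 𝒟 (ladderCoeff χ) (ladderD F) (ladderU 𝒟 χ)
    (fun h => by
      refine Finsupp.lhom_ext' fun ⟨i, k⟩ => LinearMap.ext_ring ?_
      have e1 : (χ (i - k)) h = χ (i - k - 1) (𝒟.θ h) := by
        have := hχ (i - k - 1)
        rw [sub_add_cancel] at this
        rw [this]; rfl
      have e2 : ((i : ℤ) - ((k + 1 : ℕ) : ℤ)) = i - k - 1 := by push_cast; ring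
      simp only [LinearMap.comp_apply, Module.End.mul_apply, Finsupp.lsingle_apply,
        ladderCoeff_single, ladderU_single, map_smul, map_add, smul_add, e1, e2]
      -- At `i = 0` the truncated index `i - 1` is harmless, because `ladderLower` vanishes there.
      rcases i with _ | i
      · simp [ladderLower, smul_smul, -Finsupp.smul_single, mul_comm]
      · have e3 : (((i + 1 : ℕ) : ℤ) - k - 1) = i - k := by push_cast; ring
        simp only [Nat.add_sub_cancel, e3, smul_smul, mul_comm])
    (fun h => by
      refine Finsupp.lhom_ext' fun ⟨i, k⟩ => LinearMap.ext_ring ?_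
      have e2 : (((i + 1 : ℕ) : ℤ) - (k : ℤ)) = i - k + 1 := by push_cast; ring
      simp only [LinearMap.comp_apply, Module.End.mul_apply, Finsupp.lsingle_apply,
        ladderCoeff_single, ladderD_single, map_smul, e2, hχ, AlgHom.comp_apply])
    (by
      refine Finsupp.lhom_ext' fun ⟨i, k⟩ => LinearMap.ext_ring ?_
      have e2 : ((i : ℤ) - ((k + 1 : ℕ) : ℤ)) = i - k - 1 := by push_cast; ring
      simp only [LinearMap.comp_apply, Module.End.mul_apply, Finsupp.lsingle_apply,
        ladderCoeff_single, ladderD_single, ladderU_single, map_smul, LinearMap.add_apply,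
        map_add, e2, ladderRaise, ladderLower, Nat.add_sub_cancel, add_smul, smul_smul]
      rcases i with _ | i
      · simp [ladderLower, mul_comm, add_comm]
      · have e3 : (((i + 1 : ℕ) : ℤ) - k - 1) = i - k := by push_cast; ring
        simp only [Nat.add_sub_cancel, e3, mul_comm]
        abel)

/-- On basis vectors with `i = 0`, `u` is a pure shift. So `uʲ` moves the base vector to `(0, j)`,
the coefficient scales it by `χ (-j)`, and `dⁱ` moves it to `(i, j)`. Distinct monomials thus reach
distinct basis vectors, and the coefficients of `P` can be read off. -/
theorem ladder_ordered_apply (P : ℕ × ℕ →₀ H) (p : ℕ × ℕ) :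
    ladder 𝒟 hχ (ordered 𝒟 P) (Finsupp.single (0, 0) 1) p = χ (-p.2) (P p) := by
  have hU : ∀ j : ℕ, (ladderU 𝒟 χ ^ j) (Finsupp.single (0, 0) 1) = Finsupp.single (0, j) 1 := by
    intro j
    induction j with
    | zero => simp
    | succ j ih => rw [pow_succ', Module.End.mul_apply, ih, ladderU_single]
                   simp [ladderRaise, ladderLower]
  have hD : ∀ i j : ℕ, (ladderD F ^ i) (Finsupp.single (0, j) 1) = Finsupp.single (i, j) 1 := by
    intro i j
    induction i with
    | zero => simp
    | succ i ih => rw [pow_succ', Module.End.mul_apply, ih, ladderD_single]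
  induction P using Finsupp.induction_linear with
  | zero => simp
  | add P Q hP hQ => simp [hP, hQ]
  | single q h =>
    obtain ⟨i, j⟩ := q
    rw [ordered_single]
    simp only [ladder, map_mul, map_pow, lift_d, lift_coeff, lift_u, Module.End.mul_apply, hU,
      ladderCoeff_single, map_smul, hD]
    by_cases hp : (i, j) = p
    · subst hp; simp
    · simp [hp]

end Ladder

end General

end TriangularGWA

/-! ### Highest weight modules -/

namespace TriangularGWA

section HighestWeight

variable {F : Type u} {H : Type v} [Field F] [Ring H] [Algebra F H] {𝒟 : GWAData F H}
  {M : Type w} [AddCommGroup M] [Module (TriangularGWA 𝒟) M] {μ : H →ₐ[F] F} {x : M}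

theorem IsWeightVector.d_pow_smul (hx : IsWeightVector 𝒟 μ x) (k : ℕ) :
    IsWeightVector 𝒟 (μ.comp (𝒟.θ ^ k)) (d 𝒟 ^ k • x) := by
  intro h
  rw [smul_smul, coeff_mul_d_pow, mul_smul, hx, smul_smul, smul_smul, Algebra.commutes]
  rfl

variable (𝒟 μ) in
/-- The coefficient of `dᵏ x` in `u dᵏ⁺¹ x` for a highest weight vector `x` of weight `μ`. -/
def lowerCoeff : ℕ → F
  | 0 => μ 𝒟.z₀
  | k + 1 => μ ((𝒟.θ ^ (k + 1)) 𝒟.z₀) + μ ((𝒟.θ ^ k) 𝒟.z₁) * lowerCoeff k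

theorem u_smul_d_pow_smul (hx : IsWeightVector 𝒟 μ x) (hu : u 𝒟 • x = 0) (k : ℕ) :
    u 𝒟 • d 𝒟 ^ (k + 1) • x =
      algebraMap F (TriangularGWA 𝒟) (lowerCoeff 𝒟 μ k) • d 𝒟 ^ k • x := by
  induction k with
  | zero =>
    rw [zero_add, pow_one, smul_smul, u_mul_d, add_smul, mul_smul, hu, smul_zero, add_zero,
      pow_zero, one_smul]
    exact hx _
  | succ k ih =>
    have e (c : F) : (d 𝒟 * coeff 𝒟 𝒟.z₁) • algebraMap F (TriangularGWA 𝒟) c • d 𝒟 ^ k • x =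
        algebraMap F (TriangularGWA 𝒟) (μ ((𝒟.θ ^ k) 𝒟.z₁) * c) • d 𝒟 ^ (k + 1) • x := by
      rw [smul_smul, ← Algebra.commutes, mul_smul, mul_smul, hx.d_pow_smul, ← mul_smul (d 𝒟),
        ← Algebra.commutes, mul_smul, ← mul_smul (d 𝒟), ← pow_succ', smul_smul, ← map_mul,
        mul_comm]
      rfl
    rw [pow_succ' _ (k + 1), mul_smul, ← mul_smul (u 𝒟), u_mul_d, add_smul,
      mul_smul (d 𝒟 * coeff 𝒟 𝒟.z₁), ih, e, hx.d_pow_smul, ← add_smul, ← map_add]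
    rfl

section Scalars

variable [Module F M] [IsScalarTower F (TriangularGWA 𝒟) M]

theorem span_d_pow_smul (hx : IsWeightVector 𝒟 μ x) (hu : u 𝒟 • x = 0)
    (hgen : Submodule.span (TriangularGWA 𝒟) {x} = ⊤) :
    Submodule.span F (Set.range fun k : ℕ => d 𝒟 ^ k • x) = ⊤ := by
  set S := Submodule.span F (Set.range fun k : ℕ => d 𝒟 ^ k • x) with hS
  have mem : ∀ k, d 𝒟 ^ k • x ∈ S := fun k => Submodule.subset_span ⟨k, rfl⟩
  have key : ∀ a : TriangularGWA 𝒟, (∀ k : ℕ, a • d 𝒟 ^ k • x ∈ S) →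
      ∀ y ∈ S.toAddSubgroup, a • y ∈ S.toAddSubgroup := by
    intro a ha y hy
    induction hy using Submodule.span_induction with
    | mem y hy => obtain ⟨k, rfl⟩ := hy; exact ha k
    | zero => rw [smul_zero]; exact S.zero_mem
    | add y z _ _ hy hz => rw [smul_add]; exact S.add_mem hy hz
    | smul c y _ hy =>
      rw [smul_comm]; exact S.smul_mem c hy
  refine eq_top_iff.mpr fun y _ => ?_
  obtain ⟨a, rfl⟩ := Submodule.mem_span_singleton.mp (hgen ▸ Submodule.mem_top : y ∈ _)
  refine smul_mem_of_generators S.toAddSubgroup (fun h => key _ fun k => ?_)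
    (key _ fun k => ?_) (key _ fun k => ?_) a x (by simpa using mem 0)
  · rw [hx.d_pow_smul, algebraMap_smul]
    exact S.smul_mem _ (mem k)
  · rw [smul_smul, ← pow_succ']
    exact mem _
  · rcases k with _ | k
    · rw [pow_zero, one_smul, hu]; exact S.zero_mem
    · rw [u_smul_d_pow_smul hx hu, algebraMap_smul]
      exact S.smul_mem _ (mem k)

/-- Vectors of pairwise distinct weights are independent. -/
theorem smul_d_pow_smul_eq_zero (hx : IsWeightVector 𝒟 μ x) {h₀ : H}
    (hinj : Function.Injective fun k : ℕ => μ ((𝒟.θ ^ k) h₀)) {P : ℕ →₀ F}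
    (hP : (P.sum fun k c => c • d 𝒟 ^ k • x) = 0) (k : ℕ) : P k • d 𝒟 ^ k • x = 0 := by
  -- The vectors `dᵏ x` are eigenvectors of `h₀` with distinct eigenvalues. Some of them may be
  -- zero, so only the terms, not the coefficients, are shown to vanish.
  have ind := (Module.End.eigenspaces_iSupIndep
    (Module.toModuleEnd F M (coeff 𝒟 h₀) : Module.End F M)).comp hinj
  rw [iSupIndep_iff_finsetSum_eq_zero_imp_eq_zero] at ind
  by_cases hk : k ∈ P.support
  · refine ind P.support (fun k => P k • d 𝒟 ^ k • x) (fun j _ => ?_) hP k hk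
    refine Submodule.smul_mem _ _ (Module.End.mem_eigenspace_iff.mpr ?_)
    exact (hx.d_pow_smul j h₀).trans (algebraMap_smul _ _ _)
  · rw [Finsupp.notMem_support_iff.mp hk, zero_smul]

/-- Expand `y` in the `dᵏ x` and apply `h₀ - ν(h₀)`, which kills `y`. By independence it kills each
term, so a nonzero term must have `h₀`-eigenvalue `ν(h₀)`, and injectivity leaves a single such `k`.
-/
theorem exists_eq_smul_of_isWeightVector (hx : IsWeightVector 𝒟 μ x) (hu : u 𝒟 • x = 0)
    (hgen : Submodule.span (TriangularGWA 𝒟) {x} = ⊤) {h₀ : H}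
    (hinj : Function.Injective fun k : ℕ => μ ((𝒟.θ ^ k) h₀)) {ν : H →ₐ[F] F} {y : M}
    (hy : IsWeightVector 𝒟 ν y) (hy0 : y ≠ 0) :
    ∃ (k : ℕ) (c : F), ν = μ.comp (𝒟.θ ^ k) ∧ y = c • d 𝒟 ^ k • x := by
  have hmem : y ∈ Submodule.span F (Set.range fun k : ℕ => d 𝒟 ^ k • x) := by
    rw [span_d_pow_smul hx hu hgen]; trivial
  obtain ⟨P, hP⟩ := Finsupp.mem_span_range_iff_exists_finsupp.mp hmem
  have ev : ∀ k, (P k * (μ ((𝒟.θ ^ k) h₀) - ν h₀)) • d 𝒟 ^ k • x = 0 := by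
    intro k
    -- The coefficients of `(h₀ - ν(h₀)) y`.
    let Q : ℕ →₀ F := Finsupp.ofSupportFinite (fun k => P k * (μ ((𝒟.θ ^ k) h₀) - ν h₀))
      (P.hasFiniteSupport.subset fun k hk => left_ne_zero_of_mul hk)
    refine smul_d_pow_smul_eq_zero (P := Q) hx hinj ?_ k
    have e1 := hy h₀
    rw [← hP, Finsupp.sum, Finset.smul_sum, Finset.smul_sum, ← sub_eq_zero,
      ← Finset.sum_sub_distrib] at e1
    rw [Finsupp.sum_of_support_subset Q (s := P.support) _ _ (by simp), ← e1]
    · refine Finset.sum_congr rfl fun k _ => ?_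
      rw [smul_comm (coeff 𝒟 h₀) (P k), hx.d_pow_smul, algebraMap_smul, algebraMap_smul, smul_smul,
        smul_smul, ← sub_smul, mul_comm (ν h₀), ← mul_sub]
      rfl
    · intro k hk
      simp only [Finsupp.mem_support_iff, Q, Finsupp.ofSupportFinite_coe] at hk ⊢
      exact left_ne_zero_of_mul hk
  obtain ⟨k, hk⟩ : ∃ k, P k • d 𝒟 ^ k • x ≠ 0 := by
    by_contra! h
    exact hy0 (by rw [← hP]; exact Finset.sum_eq_zero fun k _ => h k)
  have hkν : ∀ j, P j • d 𝒟 ^ j • x ≠ 0 → μ ((𝒟.θ ^ j) h₀) = ν h₀ := by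
    intro j hj
    have := ev j
    rw [mul_comm, mul_smul, smul_eq_zero, sub_eq_zero] at this
    exact this.resolve_right hj
  have hyk : y = P k • d 𝒟 ^ k • x := by
    rw [← hP]
    refine Finset.sum_eq_single k (fun j _ hjk => ?_) fun hk' => ?_
    · by_contra h
      exact hjk (hinj ((hkν j h).trans (hkν k hk).symm))
    · simp [Finsupp.notMem_support_iff.mp hk']
  refine ⟨k, P k, ?_, hyk⟩
  ext h
  have e1 := hy h
  have e2 : coeff 𝒟 h • y = algebraMap F (TriangularGWA 𝒟) ((μ.comp (𝒟.θ ^ k)) h) • y := by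
    rw [hyk, smul_comm, hx.d_pow_smul, smul_comm]
  rw [e2, algebraMap_smul, algebraMap_smul, ← sub_eq_zero, ← sub_smul, smul_eq_zero,
    sub_eq_zero] at e1
  exact (e1.resolve_right hy0).symm

end Scalars

/-- The weight multiplicities of a highest weight module with pairwise distinct weights. -/
theorem formalCharacter_comp_pow (hx : IsWeightVector 𝒟 μ x) (hu : u 𝒟 • x = 0)
    (hgen : Submodule.span (TriangularGWA 𝒟) {x} = ⊤) {h₀ : H}
    (hinj : Function.Injective fun k : ℕ => μ ((𝒟.θ ^ k) h₀)) (k : ℕ)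
    [Decidable (d 𝒟 ^ k • x = 0)] :
    formalCharacter 𝒟 M (μ.comp (𝒟.θ ^ k)) = if d 𝒟 ^ k • x = 0 then 0 else 1 := by
  -- This structure agrees definitionally with that of `RestrictScalars`, so `weightSpace` can be
  -- compared with spans in `M` itself.
  let _ : Module F M := Module.compHom M (algebraMap F (TriangularGWA 𝒟))
  have _ : IsScalarTower F (TriangularGWA 𝒟) M := ⟨fun c a y => by
    rw [Algebra.smul_def, mul_smul]; rfl⟩
  have hspan : weightSpace 𝒟 M (μ.comp (𝒟.θ ^ k)) =
      (Submodule.span F {d 𝒟 ^ k • x} : Submodule F M) := by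
    apply le_antisymm
    · intro y hy
      by_cases hy0 : (y : M) = 0
      · rw [show y = 0 from hy0]; exact Submodule.zero_mem _
      obtain ⟨j, c, hj, rfl⟩ := exists_eq_smul_of_isWeightVector hx hu hgen hinj hy hy0
      obtain rfl : k = j := hinj (DFunLike.congr_fun hj h₀)
      exact Submodule.smul_mem _ _ (Submodule.mem_span_singleton_self _)
    · refine (Submodule.span_singleton_le_iff_mem _ _).mpr ?_
      exact hx.d_pow_smul k
  rw [formalCharacter, hspan]
  split_ifs with h0
  · rw [h0, Submodule.span_zero_singleton]
    exact rank_bot F M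
  · refine (rank_span_set (R := F) (M := M) ?_).trans (Cardinal.mk_singleton _)
    exact LinearIndepOn.singleton (v := id) h0

theorem exists_eq_of_formalCharacter_ne_zero (hx : IsWeightVector 𝒟 μ x) (hu : u 𝒟 • x = 0)
    (hgen : Submodule.span (TriangularGWA 𝒟) {x} = ⊤) {h₀ : H}
    (hinj : Function.Injective fun k : ℕ => μ ((𝒟.θ ^ k) h₀)) {ν : H →ₐ[F] F}
    (hν : formalCharacter 𝒟 M ν ≠ 0) : ∃ k : ℕ, ν = μ.comp (𝒟.θ ^ k) := by
  let _ : Module F M := Module.compHom M (algebraMap F (TriangularGWA 𝒟))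
  have _ : IsScalarTower F (TriangularGWA 𝒟) M := ⟨fun c a y => by
    rw [Algebra.smul_def, mul_smul]; rfl⟩
  obtain ⟨y, hy, hy0⟩ : ∃ y : M, IsWeightVector 𝒟 ν y ∧ y ≠ 0 := by
    by_contra! h
    refine hν ?_
    have : weightSpace 𝒟 M ν = ⊥ := (Submodule.eq_bot_iff _).mpr fun y hy => h y hy
    rw [formalCharacter, this]
    exact rank_bot F _
  obtain ⟨k, _, hk, _⟩ := exists_eq_smul_of_isWeightVector hx hu hgen hinj hy hy0
  exact ⟨k, hk⟩

theorem isHighestWeightModule_of_generator (hx : IsWeightVector 𝒟 μ x) (hu : u 𝒟 • x = 0)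
    (hgen : Submodule.span (TriangularGWA 𝒟) {x} = ⊤) (hx0 : x ≠ 0) :
    IsHighestWeightModule 𝒟 μ M := by
  refine ⟨⟨x, 0, hx0⟩, Submodule.liftQ (vermaIdeal 𝒟 μ)
    (LinearMap.toSpanSingleton (TriangularGWA 𝒟) M x) ?_, fun y => ?_⟩
  · refine Submodule.span_le.mpr ?_
    rintro _ (rfl | ⟨h, hh, rfl⟩)
    · exact hu
    · refine (hx h).trans ?_
      rw [show μ h = 0 from hh, map_zero, zero_smul]
  · obtain ⟨a, ha⟩ := Submodule.mem_span_singleton.mp (hgen ▸ Submodule.mem_top : y ∈ _)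
    exact ⟨Submodule.Quotient.mk a, ha⟩

theorem IsHighestWeightModule.exists_generator (hM : IsHighestWeightModule 𝒟 μ M) :
    ∃ x : M, x ≠ 0 ∧ IsWeightVector 𝒟 μ x ∧ u 𝒟 • x = 0 ∧
      Submodule.span (TriangularGWA 𝒟) {x} = ⊤ := by
  obtain ⟨hnt, π, hπ⟩ := hM
  let ρ : TriangularGWA 𝒟 →ₗ[TriangularGWA 𝒟] M := π ∘ₗ Submodule.mkQ (vermaIdeal 𝒟 μ)
  have hρ : ∀ a, a • ρ 1 = ρ a := fun a => by rw [← map_smul, smul_eq_mul, mul_one]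
  have hρ0 : ∀ a ∈ vermaIdeal 𝒟 μ, ρ a = 0 := fun a ha => by
    change π (Submodule.Quotient.mk a) = 0
    rw [(Submodule.Quotient.mk_eq_zero _).mpr ha]
    exact map_zero π
  have hsurj : Function.Surjective ρ := hπ.comp (Submodule.mkQ_surjective _)
  have hgen : Submodule.span (TriangularGWA 𝒟) {ρ 1} = ⊤ := eq_top_iff.mpr fun y _ => by
    obtain ⟨a, rfl⟩ := hsurj y
    exact Submodule.mem_span_singleton.mpr ⟨a, hρ a⟩
  refine ⟨ρ 1, fun h => ?_, fun h => ?_, ?_, hgen⟩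
  · rw [h, Submodule.span_zero_singleton] at hgen
    exact bot_ne_top hgen
  · rw [hρ, hρ, ← sub_eq_zero, ← map_sub, ← AlgHom.commutes (coeff 𝒟), ← map_sub]
    refine hρ0 _ (Ideal.subset_span (Or.inr ⟨_, ?_, rfl⟩))
    simp
  · rw [hρ]
    exact hρ0 _ (Ideal.subset_span (Or.inl rfl))

/-- Any generator of weight `μ` of a highest weight module is killed by `u`. -/
theorem IsHighestWeightModule.u_smul_eq_zero (hM : IsHighestWeightModule 𝒟 μ M) {h₀ : H}
    (hinj : Function.Injective fun k : ℕ => μ ((𝒟.θ ^ k) h₀)) (hx : IsWeightVector 𝒟 μ x) :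
    u 𝒟 • x = 0 := by
  let _ : Module F M := Module.compHom M (algebraMap F (TriangularGWA 𝒟))
  have _ : IsScalarTower F (TriangularGWA 𝒟) M := ⟨fun c a y => by
    rw [Algebra.smul_def, mul_smul]; rfl⟩
  obtain ⟨y, hy0, hy, hu, hgen⟩ := hM.exists_generator
  by_cases hx0 : x = 0
  · rw [hx0, smul_zero]
  obtain ⟨k, c, hk, rfl⟩ := exists_eq_smul_of_isWeightVector hy hu hgen hinj hx hx0
  -- Distinct weights force `k = 0`, so the given vector is a multiple of the canonical generator.
  obtain rfl : 0 = k := hinj (DFunLike.congr_fun hk h₀)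
  rw [pow_zero, one_smul, smul_comm, hu, smul_zero]

end HighestWeight

end TriangularGWA

/-! ### Rational functions regular at `q = 1` -/

section Regular

variable {F : Type u} [Field F]

theorem div_mem_regularAtOne (a : F[X]) {b : F[X]} (hb : b.eval 1 ≠ 0) :
    algebraMap F[X] (RatFunc F) a / algebraMap F[X] (RatFunc F) b ∈ regularAtOne F := by
  intro h
  have h1 := Polynomial.eval_dvd (x := (1 : F)) (RatFunc.denom_div_dvd a b)
  rw [h, zero_dvd_iff] at h1
  exact hb h1

/-- Evaluation at `q = 1`. -/
noncomputable def evalOne : regularAtOne F →ₐ[F] F where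
  toFun r := RatFunc.eval (RingHom.id F) 1 r
  map_one' := RatFunc.eval_one _ _
  map_zero' := RatFunc.eval_zero _ _
  map_add' a b := RatFunc.eval_add _ _ a.2 b.2
  map_mul' a b := RatFunc.eval_mul _ _ a.2 b.2
  commutes' c := by
    change RatFunc.eval _ _ (algebraMap F (RatFunc F) c) = _
    rw [RatFunc.algebraMap_eq_C, RatFunc.eval_C]
    rfl

theorem ratFunc_X_sub_one_ne_zero : (RatFunc.X - 1 : RatFunc F) ≠ 0 := by
  intro h
  have : algebraMap F[X] (RatFunc F) (Polynomial.X - Polynomial.C 1) = 0 := by simpa using h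
  exact Polynomial.X_sub_C_ne_zero (1 : F)
    (RatFunc.algebraMap_injective F (this.trans (map_zero _).symm))

@[simp]
theorem evalOne_qSubOne : evalOne (qSubOne F) = 0 := by
  have h : (RatFunc.X - 1 : RatFunc F) = algebraMap F[X] (RatFunc F) (Polynomial.X - 1) := by
    simp
  change RatFunc.eval _ _ (RatFunc.X - 1 : RatFunc F) = 0
  rw [h, RatFunc.eval_algebraMap]
  simp

/-- The numerator has a root at `1`; dividing it by `q - 1` leaves the denominator unchanged. -/
theorem exists_mul_qSubOne_of_evalOne_eq_zero {r : regularAtOne F} (hr : evalOne r = 0) :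
    ∃ r', r = r' * qSubOne F := by
  have h1 : (r : RatFunc F).num.eval 1 = 0 := by
    have h2 : (r : RatFunc F).num.eval₂ (RingHom.id F) 1 /
      (r : RatFunc F).denom.eval₂ (RingHom.id F) 1 = 0 := hr
    exact (div_eq_zero_iff.mp h2).resolve_right r.2
  obtain ⟨a, ha⟩ := Polynomial.dvd_iff_isRoot.mpr h1
  refine ⟨⟨_, div_mem_regularAtOne a r.2⟩, Subtype.ext ?_⟩
  change (r : RatFunc F) = _ * (RatFunc.X - 1 : RatFunc F)
  conv_lhs => rw [← RatFunc.num_div_denom (r : RatFunc F), ha]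
  rw [map_mul, div_mul_eq_mul_div, mul_comm (algebraMap F[X] (RatFunc F) a)]
  simp

/-- Inversion exchanges numerator and denominator, so `R` is local with maximal ideal the kernel of
`evalOne`. -/
theorem exists_inv_of_evalOne_ne_zero {r : regularAtOne F} (hr : evalOne r ≠ 0) :
    ∃ r' : regularAtOne F, (r' : RatFunc F) = (r : RatFunc F)⁻¹ := by
  have h1 : (r : RatFunc F).num.eval 1 ≠ 0 := fun h => hr (by
    change (r : RatFunc F).num.eval₂ (RingHom.id F) 1 /
      (r : RatFunc F).denom.eval₂ (RingHom.id F) 1 = 0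
    rw [← Polynomial.eval₂_id] at h
    rw [h, zero_div])
  refine ⟨⟨_, div_mem_regularAtOne (r : RatFunc F).denom h1⟩, ?_⟩
  conv_rhs => rw [← RatFunc.num_div_denom (r : RatFunc F), inv_div]

/-! ### Units of `F(q)` deforming `1`, with their first-order term. -/

/-- The unit `q` of `F(q)`. -/
noncomputable def ratFuncQ (F : Type u) [Field F] : (RatFunc F)ˣ :=
  Units.mk0 RatFunc.X RatFunc.X_ne_zero

/-- The unit `x` of `F(q)` satisfies `(x - 1) / (q - 1) ∈ R`, and this element has the value `c`
at `q = 1`. -/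
def Deforms (x : (RatFunc F)ˣ) (c : F) : Prop :=
  ∃ r : regularAtOne F, (x : RatFunc F) = 1 + (r : RatFunc F) * (RatFunc.X - 1) ∧ evalOne r = c

namespace Deforms

variable {x y : (RatFunc F)ˣ} {a b c : F}

/-- The unit `x`, as an element of `R`. -/
theorem exists_coe (hx : Deforms x a) :
    ∃ r : regularAtOne F, (r : RatFunc F) = x ∧ evalOne r = 1 := by
  obtain ⟨r, hr, _⟩ := hx
  refine ⟨1 + r * qSubOne F, ?_, by simp⟩
  rw [hr]; rfl

theorem exists_coe_inv (hx : Deforms x a) :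
    ∃ r : regularAtOne F, (r : RatFunc F) = (x⁻¹ : (RatFunc F)ˣ) ∧ evalOne r = 1 := by
  obtain ⟨r, hr, hr1⟩ := hx.exists_coe
  obtain ⟨r', hr'⟩ := exists_inv_of_evalOne_ne_zero (r := r) (by simp [hr1])
  refine ⟨r', by rw [hr', hr]; simp, ?_⟩
  have : r' * r = 1 := Subtype.ext (by
    change (r' : RatFunc F) * r = 1
    rw [hr', hr]; simp)
  simpa [hr1] using congrArg evalOne this

theorem one : Deforms (1 : (RatFunc F)ˣ) 0 := ⟨0, by simp, by simp⟩

/-- The cross term `r t (q - 1)` vanishes at `q = 1`, so the first-order term behaves like a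
logarithmic derivative. -/
theorem mul (hx : Deforms x a) (hy : Deforms y b) : Deforms (x * y) (a + b) := by
  obtain ⟨r, hr, rfl⟩ := hx
  obtain ⟨t, ht, rfl⟩ := hy
  refine ⟨r + t + r * t * qSubOne F, ?_, by simp⟩
  have : ((r + t + r * t * qSubOne F : regularAtOne F) : RatFunc F) =
      (r : RatFunc F) + (t : RatFunc F) + (r : RatFunc F) * (t : RatFunc F) * (RatFunc.X - 1) := rfl
  rw [Units.val_mul, hr, ht, this]
  ring

theorem inv (hx : Deforms x a) : Deforms x⁻¹ (-a) := by
  obtain ⟨r', hr', hr'1⟩ := hx.exists_coe_inv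
  obtain ⟨r, hr, rfl⟩ := hx
  refine ⟨-r * r', ?_, by simp [hr'1]⟩
  have e : ((-r * r' : regularAtOne F) : RatFunc F) = -r * r' := rfl
  rw [e, hr']
  have hx : (x : RatFunc F) * (x⁻¹ : (RatFunc F)ˣ) = 1 := x.mul_inv
  linear_combination (-((x⁻¹ : (RatFunc F)ˣ) : RatFunc F)) * hr + hx

theorem zpow (hx : Deforms x a) (j : ℤ) : Deforms (x ^ j) (j * a) := by
  induction j using Int.induction_on with
  | zero => simpa using one
  | succ i ih =>
    rw [zpow_add, zpow_one]
    convert ih.mul hx using 1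
    push_cast; ring
  | pred i ih =>
    rw [zpow_sub, zpow_one]
    convert ih.mul hx.inv using 1
    push_cast; ring

theorem ratFuncX : Deforms (ratFuncQ F) 1 := ⟨1, by simp [ratFuncQ], by simp⟩

theorem eq (hx : Deforms x a) (hx' : Deforms x b) : a = b := by
  obtain ⟨r, hr, rfl⟩ := hx
  obtain ⟨t, ht, rfl⟩ := hx'
  congr 1
  refine Subtype.ext (mul_right_cancel₀ ratFunc_X_sub_one_ne_zero ?_)
  rw [hr] at ht
  exact add_left_cancel ht

theorem exists_deforms (c : F) : ∃ x : (RatFunc F)ˣ, Deforms x c := by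
  let r : regularAtOne F := 1 + algebraMap F _ c * qSubOne F
  have hr : (r : RatFunc F) ≠ 0 := fun h => by
    have h1 : evalOne r = 1 := by simp [r]
    rw [show r = 0 from Subtype.ext h, map_zero] at h1
    exact zero_ne_one h1
  exact ⟨Units.mk0 _ hr, algebraMap F _ c, rfl, by simp⟩

end Deforms

/-! ### Weights of `H_q` -/

@[simp]
theorem laurentLift_T {k A : Type*} [Field k] [CommRing A] [Algebra k A] (x : Aˣ) (n : ℤ) :
    laurentLift (k := k) x (LaurentPolynomial.T n) = ((x ^ n : Aˣ) : A) :=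
  LaurentPolynomial.eval₂_T _ _ n

@[simp]
theorem laurentLift_C {k A : Type*} [Field k] [CommRing A] [Algebra k A] (x : Aˣ) (c : k) :
    laurentLift (k := k) x (LaurentPolynomial.C c) = algebraMap k A c :=
  LaurentPolynomial.eval₂_C _ _ c

theorem laurent_algHom_ext {k A : Type*} [Field k] [CommRing A] [Algebra k A]
    {φ ψ : k[T;T⁻¹] →ₐ[k] A} (h : ∀ n, φ (LaurentPolynomial.T n) = ψ (LaurentPolynomial.T n)) :
    φ = ψ :=
  AddMonoidAlgebra.algHom_ext h (Subsingleton.elim _ _)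

theorem laurentLift_comp_laurentLift_qShiftK (l : ℤ) (x : (RatFunc F)ˣ) :
    (laurentLift x).comp (laurentLift (qShiftK F l)) =
      (laurentLift (ratFuncQ F ^ (-l) * x) : (RatFunc F)[T;T⁻¹] →ₐ[RatFunc F] RatFunc F) := by
  refine laurent_algHom_ext fun n => ?_
  have h : Units.map (laurentLift x : (RatFunc F)[T;T⁻¹] →ₐ[RatFunc F] RatFunc F).toMonoidHom
      (qShiftK F l) = ratFuncQ F ^ (-l) * x := by
    ext
    simp [qShiftK, ratFuncQ]
  rw [laurentLift_T, ← h, ← map_zpow, AlgHom.comp_apply, laurentLift_T]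
  rfl

/-- The value of `(K; 0)_q` at `K = x` is `(x - 1)/(q - 1)`, which is exactly the element of `R`
supplied by `Deforms`. -/
theorem Deforms.laurentLift_quantumK0 {x : (RatFunc F)ˣ} {c : F} (hx : Deforms x c) :
    ∃ r : regularAtOne F, laurentLift x (quantumK0 F) = (r : RatFunc F) ∧ evalOne r = c := by
  obtain ⟨r, hr, hc⟩ := hx
  refine ⟨r, ?_, hc⟩
  rw [quantumK0, map_mul, map_sub, map_one, laurentLift_C, laurentLift_T, zpow_one, hr,
    add_sub_cancel_left, mul_comm]
  exact mul_inv_cancel_right₀ ratFunc_X_sub_one_ne_zero _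

theorem Deforms.laurentLift_T {x : (RatFunc F)ˣ} {c : F} (hx : Deforms x c) (n : ℤ) :
    ∃ r : regularAtOne F, laurentLift x (LaurentPolynomial.T n : (RatFunc F)[T;T⁻¹]) =
      (r : RatFunc F) ∧ evalOne r = 1 := by
  obtain ⟨r, hr, hr1⟩ := (hx.zpow n).exists_coe
  exact ⟨r, by rw [_root_.laurentLift_T, hr], hr1⟩

theorem Deforms.laurentLift_aeval {x : (RatFunc F)ˣ} {c : F} (hx : Deforms x c) (t : F)
    (p : F[X]) : ∃ r : regularAtOne F, laurentLift x (Polynomial.aeval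
      (LaurentPolynomial.C (RatFunc.C t) * quantumK0 F) p) = (r : RatFunc F) ∧
      evalOne r = p.eval (t * c) := by
  obtain ⟨r, hr, rfl⟩ := hx.laurentLift_quantumK0
  refine ⟨Polynomial.aeval (algebraMap F (regularAtOne F) t * r) p, ?_, ?_⟩
  · have e : ((Polynomial.aeval (algebraMap F (regularAtOne F) t * r) p : regularAtOne F) :
        RatFunc F) = Polynomial.aeval (RatFunc.C t * r) p :=
      (Polynomial.aeval_algHom_apply (regularAtOne F).val _ p).symm
    rw [e, ← hr]
    clear e
    induction p using Polynomial.induction_on' with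
    | add p q hp hq => simp only [map_add, hp, hq]
    | monomial n a =>
      simp only [Polynomial.aeval_monomial, map_mul, map_pow, laurentLift_C]
      congr 1
      exact laurentLift_C x (RatFunc.C a)
  · rw [← Polynomial.aeval_algHom_apply, ← Polynomial.coe_aeval_eq_eval]
    simp

variable {γ s : F} {f : F[X]} {l m n : ℤ}

theorem Deforms.laurentLift_z₀ {x : (RatFunc F)ˣ} {c : F} (hx : Deforms x c) :
    laurentLift x (quantumData γ s f l m n).z₀ ∈ regularAtOne F := by
  obtain ⟨r, hr, _⟩ := hx.laurentLift_aeval (-γ / l) f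
  obtain ⟨r', hr', _⟩ := hx.laurentLift_T n
  -- Evaluating `T m` at `q` itself puts `qᵐ` in `R`, also for negative `m`.
  obtain ⟨r'', hr'', _⟩ := (Deforms.ratFuncX (F := F)).laurentLift_T m
  rw [_root_.laurentLift_T] at hr''
  rw [quantumData, map_mul, map_mul, hr, hr', laurentLift_C]
  refine mul_mem (mul_mem (mul_mem ?_ ?_) r'.2) r.2
  · exact (regularAtOne F).algebraMap_mem s⁻¹
  · convert r''.2
    rw [← hr'', Units.val_zpow_eq_zpow_val]
    rfl

theorem laurentLift_z₁_mem (x : (RatFunc F)ˣ) :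
    laurentLift x (quantumData γ s f l m n).z₁ ∈ regularAtOne F := by
  rw [quantumData, laurentLift_C]
  exact (regularAtOne F).algebraMap_mem s⁻¹

/-- The weight `K ↦ q⁻ˡʲ x` of `H_q`. -/
noncomputable def shiftedWeight (l : ℤ) (x : (RatFunc F)ˣ) (j : ℤ) :
    (RatFunc F)[T;T⁻¹] →ₐ[RatFunc F] RatFunc F :=
  laurentLift (ratFuncQ F ^ (-l * j) * x)

theorem Deforms.shift {x : (RatFunc F)ˣ} {c : F} (hx : Deforms x c) (j : ℤ) :
    Deforms (ratFuncQ F ^ (-l * j) * x) (c - l * j) := by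
  convert (Deforms.ratFuncX.zpow (-l * j)).mul hx using 1
  push_cast; ring

theorem shiftedWeight_add_one (x : (RatFunc F)ˣ) (j : ℤ) :
    shiftedWeight l x (j + 1) = (shiftedWeight l x j).comp (quantumData γ s f l m n).θ := by
  rw [shiftedWeight, shiftedWeight, quantumData, laurentLift_comp_laurentLift_qShiftK,
    ← mul_assoc, ← zpow_add]
  congr 3
  ring

theorem laurentLift_comp_θ_pow (x : (RatFunc F)ˣ) (k : ℕ) :
    (laurentLift x).comp ((quantumData γ s f l m n).θ ^ k) = shiftedWeight l x k := by
  induction k with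
  | zero => simp [shiftedWeight]; rfl
  | succ k ih =>
    rw [Nat.cast_succ, shiftedWeight_add_one (γ := γ) (s := s) (f := f) (m := m) (n := n), ← ih,
      pow_succ]
    rfl

theorem laurentLift_θ_pow_apply (x : (RatFunc F)ˣ) (k : ℕ) (g : (RatFunc F)[T;T⁻¹]) :
    (laurentLift x : (RatFunc F)[T;T⁻¹] →ₐ[RatFunc F] RatFunc F)
      (((quantumData γ s f l m n).θ ^ k) g) = shiftedWeight l x k g := by
  rw [← laurentLift_comp_θ_pow (γ := γ) (s := s) (f := f) (m := m) (n := n), AlgHom.comp_apply]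

theorem downUp_θ_pow_X (k : ℕ) : ((downUpData γ s f).θ ^ k) Polynomial.X =
    Polynomial.X + Polynomial.C (k * γ) := by
  induction k with
  | zero => simp
  | succ k ih =>
    rw [pow_succ']
    change (downUpData γ s f).θ (((downUpData γ s f).θ ^ k) Polynomial.X) = _
    rw [ih, downUpData, map_add, Polynomial.aeval_X, Polynomial.aeval_C,
      Polynomial.algebraMap_eq]
    push_cast
    simp only [map_mul, map_add, map_natCast, map_one]
    ring

end Regular

/-! ### The classical limit of the quantum algebra -/

namespace QuantumGWA

variable {F : Type u} [Field F] {γ s : F} {f : F[X]} {l m n : ℤ}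

/-- The element `a` of `𝓦_q` lies in the `R`-form, and its class in `𝓦₁` is `b`. -/
def SpecializesTo (a : QuantumGWA γ s f l m n) (b : ClassicalLimit γ s f l m n) : Prop :=
  ∃ y : RForm γ s f l m n, RForm.incl γ s f l m n y = a ∧ toLimit γ s f l m n y = b

theorem RForm.incl_injective : Function.Injective (RForm.incl γ s f l m n) :=
  Subtype.val_injective

theorem toLimit_surjective : Function.Surjective (toLimit γ s f l m n) :=
  Ideal.Quotient.mk_surjective

/-- The difference `r - r(1)` is divisible by `q - 1` in `R`, hence dies in the quotient. -/
theorem toLimit_algebraMap (r : regularAtOne F) :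
    toLimit γ s f l m n (algebraMap (regularAtOne F) (RForm γ s f l m n) r) =
      algebraMap F (ClassicalLimit γ s f l m n) (evalOne r) := by
  obtain ⟨r', hr'⟩ := exists_mul_qSubOne_of_evalOne_eq_zero
    (r := r - algebraMap F (regularAtOne F) (evalOne r)) (by simp)
  have h0 : toLimit γ s f l m n
      (algebraMap (regularAtOne F) (RForm γ s f l m n) (qSubOne F)) = 0 :=
    Ideal.Quotient.eq_zero_iff_mem.mpr (Ideal.subset_span rfl)
  have h1 := congrArg (fun x => toLimit γ s f l m n (algebraMap _ (RForm γ s f l m n) x)) hr'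
  simp only [map_sub, map_mul, h0, mul_zero] at h1
  exact sub_eq_zero.mp h1

theorem toLimit_eq_zero_iff {y : RForm γ s f l m n} : toLimit γ s f l m n y = 0 ↔
    ∃ z, y = algebraMap (regularAtOne F) (RForm γ s f l m n) (qSubOne F) * z := by
  refine Ideal.Quotient.eq_zero_iff_mem.trans (Ideal.mem_span_singleton'.trans ?_)
  simp only [Algebra.commutes, eq_comm]

namespace SpecializesTo

variable {a a' : QuantumGWA γ s f l m n} {b b' : ClassicalLimit γ s f l m n}

/-- The inclusion of the `R`-form is injective, so the class depends only on the element of `𝓦_q`.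
This is how identities in `𝓦_q` become identities in `𝓦₁`. -/
theorem eq (h : SpecializesTo a b) (h' : SpecializesTo a b') : b = b' := by
  obtain ⟨y, rfl, rfl⟩ := h
  obtain ⟨y', hy, rfl⟩ := h'
  rw [RForm.incl_injective hy]

theorem add (h : SpecializesTo a b) (h' : SpecializesTo a' b') :
    SpecializesTo (a + a') (b + b') := by
  obtain ⟨y, rfl, rfl⟩ := h
  obtain ⟨y', rfl, rfl⟩ := h'
  exact ⟨y + y', map_add _ _ _, map_add _ _ _⟩

theorem mul (h : SpecializesTo a b) (h' : SpecializesTo a' b') :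
    SpecializesTo (a * a') (b * b') := by
  obtain ⟨y, rfl, rfl⟩ := h
  obtain ⟨y', rfl, rfl⟩ := h'
  exact ⟨y * y', map_mul _ _ _, map_mul _ _ _⟩

theorem pow (h : SpecializesTo a b) (k : ℕ) : SpecializesTo (a ^ k) (b ^ k) := by
  obtain ⟨y, rfl, rfl⟩ := h
  exact ⟨y ^ k, map_pow _ _ _, map_pow _ _ _⟩

theorem one : SpecializesTo (1 : QuantumGWA γ s f l m n) 1 := ⟨1, map_one _, map_one _⟩

theorem zero : SpecializesTo (0 : QuantumGWA γ s f l m n) 0 := ⟨0, map_zero _, map_zero _⟩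

theorem scalar (r : regularAtOne F) :
    SpecializesTo (algebraMap (RatFunc F) (QuantumGWA γ s f l m n) r)
      (algebraMap F (ClassicalLimit γ s f l m n) (evalOne r)) :=
  ⟨algebraMap (regularAtOne F) _ r, rfl, toLimit_algebraMap r⟩

theorem coeff_C (r : regularAtOne F) :
    SpecializesTo (coeff γ s f l m n (LaurentPolynomial.C (r : RatFunc F)))
      (algebraMap F (ClassicalLimit γ s f l m n) (evalOne r)) := by
  convert scalar r
  exact (coeff γ s f l m n).commutes _

theorem U : SpecializesTo (QuantumGWA.U γ s f l m n) (toLimit γ s f l m n (rU γ s f l m n)) :=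
  ⟨rU γ s f l m n, rfl, rfl⟩

theorem D : SpecializesTo (QuantumGWA.D γ s f l m n) (toLimit γ s f l m n (rD γ s f l m n)) :=
  ⟨rD γ s f l m n, rfl, rfl⟩

theorem coeff_quantumK0 : SpecializesTo (coeff γ s f l m n (quantumK0 F))
    (toLimit γ s f l m n (rK0 γ s f l m n)) :=
  ⟨rK0 γ s f l m n, rfl, rfl⟩

/-- Write `K = 1 + (q - 1)(K; 0)_q`. -/
theorem coeff_T_one : SpecializesTo (coeff γ s f l m n (LaurentPolynomial.T 1)) 1 := by
  have h : (LaurentPolynomial.T 1 : (RatFunc F)[T;T⁻¹]) =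
      1 + LaurentPolynomial.C ((qSubOne F : regularAtOne F) : RatFunc F) * quantumK0 F := by
    rw [quantumK0, ← mul_assoc, ← map_mul]
    change _ = 1 + LaurentPolynomial.C ((RatFunc.X - 1 : RatFunc F) * _) * _
    rw [mul_inv_cancel₀ ratFunc_X_sub_one_ne_zero]
    simp
  rw [h, map_add, map_one, map_mul]
  simpa using one.add ((coeff_C (qSubOne F)).mul coeff_quantumK0)

theorem coeff_T_neg_one : SpecializesTo (coeff γ s f l m n (LaurentPolynomial.T (-1))) 1 := by
  let y : RForm γ s f l m n :=
    (⟨coeff γ s f l m n (LaurentPolynomial.T (-1)), Algebra.subset_adjoin (by simp)⟩ :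
      rSubalgebra γ s f l m n)
  have hy : SpecializesTo (coeff γ s f l m n (LaurentPolynomial.T (-1)))
    (toLimit γ s f l m n y) := ⟨y, rfl, rfl⟩
  have h := hy.mul coeff_T_one
  rw [← map_mul, ← LaurentPolynomial.T_add, neg_add_cancel, LaurentPolynomial.T_zero, map_one,
    mul_one] at h
  rwa [h.eq one] at hy

theorem coeff_T (k : ℤ) : SpecializesTo (coeff γ s f l m n (LaurentPolynomial.T k)) 1 := by
  induction k using Int.induction_on with
  | zero => simpa using one
  | succ i ih =>
    rw [LaurentPolynomial.T_add, map_mul]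
    simpa using ih.mul coeff_T_one
  | pred i ih =>
    rw [sub_eq_add_neg, LaurentPolynomial.T_add, map_mul]
    simpa using ih.mul coeff_T_neg_one

theorem coeff_aeval {g : (RatFunc F)[T;T⁻¹]} (h : SpecializesTo (coeff γ s f l m n g) b)
    (p : F[X]) : SpecializesTo (coeff γ s f l m n (Polynomial.aeval g p))
      (Polynomial.aeval b p) := by
  induction p using Polynomial.induction_on' with
  | add p q hp hq => simpa only [map_add] using hp.add hq
  | monomial k a =>
    simp only [Polynomial.aeval_monomial, map_mul, map_pow]
    refine mul ?_ (h.pow k)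
    simpa using coeff_C (γ := γ) (s := s) (f := f) (l := l) (m := m) (n := n)
      (algebraMap F (regularAtOne F) a)

end SpecializesTo

variable (F γ l) in
/-- The element `-(γ / l) (K; 0)_q` of `H_q`, which specializes to `h`. -/
noncomputable def quantumH : (RatFunc F)[T;T⁻¹] :=
  LaurentPolynomial.C (RatFunc.C (-γ / (l : F))) * quantumK0 F

variable (γ s f l m n) in
/-- The class of `-(γ / l) (K; 0)_q` in `𝓦₁`. -/
noncomputable def limitH : ClassicalLimit γ s f l m n :=
  (-γ / (l : F)) • toLimit γ s f l m n (rK0 γ s f l m n)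

theorem specializesTo_quantumH :
    SpecializesTo (coeff γ s f l m n (quantumH F γ l)) (limitH γ s f l m n) := by
  rw [limitH, Algebra.smul_def, quantumH, map_mul]
  refine SpecializesTo.mul ?_ SpecializesTo.coeff_quantumK0
  simpa using SpecializesTo.coeff_C (γ := γ) (s := s) (f := f) (l := l) (m := m) (n := n)
    (algebraMap F (regularAtOne F) (-γ / l))

/-- The twist sends `(K; 0)_q` to `q⁻ˡ (K; 0)_q + (q⁻ˡ - 1)/(q - 1)`. The last fraction has value
`-l` at `q = 1`, and the factor `-γ/l` normalizes it to `γ`. -/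
theorem θ_quantumH (hl : (l : F) ≠ 0) : ∃ r₁ r₂ : regularAtOne F,
    (quantumData γ s f l m n).θ (quantumH F γ l) =
      LaurentPolynomial.C (r₁ : RatFunc F) * quantumH F γ l +
        LaurentPolynomial.C (r₂ : RatFunc F) ∧ evalOne r₁ = 1 ∧ evalOne r₂ = γ := by
  have hq := (Deforms.ratFuncX (F := F)).zpow (-l)
  obtain ⟨r₁, h₁, e₁⟩ := hq.exists_coe
  obtain ⟨r₂, h₂, e₂⟩ := hq
  refine ⟨r₁, r₂ * algebraMap F _ (-γ / l), ?_, e₁, ?_⟩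
  · have hX : (RatFunc.X : RatFunc F) ^ (-l) = r₁ := by
      rw [h₁, Units.val_zpow_eq_zpow_val]; rfl
    have e3 : ((r₂ * algebraMap F (regularAtOne F) (-γ / l) : regularAtOne F) : RatFunc F) =
      (r₂ : RatFunc F) * (RatFunc.C (-γ / l) : RatFunc F) := rfl
    have e4 : (r₂ : RatFunc F) = ((r₁ : RatFunc F) - 1) * (RatFunc.X - 1)⁻¹ := by
      rw [h₁, h₂, add_sub_cancel_left, mul_inv_cancel_right₀ ratFunc_X_sub_one_ne_zero]
    rw [e3, e4]
    simp only [quantumH, quantumK0, quantumData, map_mul, map_sub, map_one, laurentLift_C,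
      laurentLift_T, zpow_one, qShiftK, hX, LaurentPolynomial.algebraMap_apply]
    simp only [Algebra.algebraMap_self, RingHom.id_apply]
    ring
  · rw [map_mul, e₂, AlgHom.commutes]
    simp only [Algebra.algebraMap_self, RingHom.id_apply]
    push_cast
    field_simp

theorem specializesTo_θ_quantumH (hl : (l : F) ≠ 0) :
    SpecializesTo (coeff γ s f l m n ((quantumData γ s f l m n).θ (quantumH F γ l)))
      (limitH γ s f l m n + algebraMap F _ γ) := by
  obtain ⟨r₁, r₂, h, e₁, e₂⟩ := θ_quantumH (γ := γ) (s := s) (f := f) (m := m) (n := n) hl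
  rw [h, map_add, map_mul]
  simpa [e₁, e₂] using ((SpecializesTo.coeff_C r₁).mul specializesTo_quantumH).add
    (SpecializesTo.coeff_C r₂)

theorem θ_aeval (g : (RatFunc F)[T;T⁻¹]) (p : F[X]) :
    (quantumData γ s f l m n).θ (Polynomial.aeval g p) =
      Polynomial.aeval ((quantumData γ s f l m n).θ g) p := by
  have : IsScalarTower F (RatFunc F) (RatFunc F)[T;T⁻¹] :=
    IsScalarTower.of_algebraMap_eq fun _ => rfl
  exact (Polynomial.aeval_algHom_apply ((quantumData γ s f l m n).θ.restrictScalars F) g p).symm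

theorem aeval_limitH_θ (p : F[X]) :
    Polynomial.aeval (limitH γ s f l m n) ((downUpData γ s f).θ p) =
      Polynomial.aeval (limitH γ s f l m n + algebraMap F _ γ) p := by
  rw [downUpData, ← Polynomial.aeval_algHom_apply]
  simp

theorem specializesTo_θ_aeval (hl : (l : F) ≠ 0) (p : F[X]) : SpecializesTo
    (coeff γ s f l m n ((quantumData γ s f l m n).θ (Polynomial.aeval (quantumH F γ l) p)))
    (Polynomial.aeval (limitH γ s f l m n) ((downUpData γ s f).θ p)) := by
  rw [θ_aeval, aeval_limitH_θ]
  exact (specializesTo_θ_quantumH hl).coeff_aeval p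

/-! ### The comparison homomorphism and its surjectivity. -/

variable (γ s f l m n) in
/-- The homomorphism from the generalized down-up algebra to the classical limit. -/
noncomputable def limitHom (hl : (l : F) ≠ 0) :
    DownUpAlgebra γ s f →ₐ[F] ClassicalLimit γ s f l m n :=
  TriangularGWA.lift (downUpData γ s f) (Polynomial.aeval (limitH γ s f l m n))
    (toLimit γ s f l m n (rD γ s f l m n)) (toLimit γ s f l m n (rU γ s f l m n))
    (fun p => by
      -- Both sides of the relation are classes of one element of `𝓦_q`, rewritten there by the
      -- quantum relation.
      have h := SpecializesTo.U.mul (specializesTo_quantumH.coeff_aeval (m := m) (n := n)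
        (s := s) (f := f) (l := l) (γ := γ) p)
      rw [U, coeff, TriangularGWA.u_mul_coeff] at h
      exact h.eq ((specializesTo_θ_aeval hl p).mul SpecializesTo.U))
    (fun p => by
      have h := (specializesTo_quantumH.coeff_aeval (m := m) (n := n)
        (s := s) (f := f) (l := l) (γ := γ) p).mul SpecializesTo.D
      rw [D, coeff, TriangularGWA.coeff_mul_d] at h
      exact h.eq (SpecializesTo.D.mul (specializesTo_θ_aeval hl p)))
    (by
      have h := (SpecializesTo.U (γ := γ) (s := s) (f := f) (l := l) (m := m) (n := n)).mul
        SpecializesTo.D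
      rw [U, D, TriangularGWA.u_mul_d] at h
      refine h.eq (SpecializesTo.add ?_ ((SpecializesTo.D.mul ?_).mul SpecializesTo.U))
      -- Both `qᵐ` and `Kⁿ` specialize to `1`, so only `s⁻¹ f` remains of `z₀`.
      · obtain ⟨r, hr, hr1⟩ := ((Deforms.ratFuncX (F := F)).zpow m).exists_coe
        have e : (algebraMap F (regularAtOne F) s⁻¹ * r : regularAtOne F) =
            RatFunc.C s⁻¹ * (RatFunc.X : RatFunc F) ^ m := by
          change RatFunc.C s⁻¹ * (r : RatFunc F) = _
          rw [hr, Units.val_zpow_eq_zpow_val]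
          rfl
        have h1 := ((SpecializesTo.coeff_C (algebraMap F (regularAtOne F) s⁻¹ * r)).mul
          (SpecializesTo.coeff_T n)).mul (specializesTo_quantumH.coeff_aeval (m := m) (n := n)
            (s := s) (f := f) (l := l) (γ := γ) f)
        rw [e, ← map_mul, ← map_mul] at h1
        convert h1 using 1
        · rfl
        · simp [hr1, downUpData]
      · have h1 := SpecializesTo.coeff_C (γ := γ) (s := s) (f := f) (l := l)
          (m := m) (n := n) (algebraMap F (regularAtOne F) s⁻¹)
        convert h1 using 1
        · rfl
        · simp [downUpData])

theorem limitHom_surjective (hγ : γ ≠ 0) (hl : (l : F) ≠ 0) :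
    Function.Surjective (limitHom γ s f l m n hl) := by
  intro b
  obtain ⟨⟨a, ha⟩, rfl⟩ := toLimit_surjective b
  suffices h : ∃ x, SpecializesTo a (limitHom γ s f l m n hl x) by
    obtain ⟨x, hx⟩ := h
    exact ⟨x, hx.eq ⟨⟨a, ha⟩, rfl, rfl⟩⟩
  induction ha using Algebra.adjoin_induction with
  | mem a ha =>
    rcases ha with rfl | rfl | rfl | rfl | rfl
    · exact ⟨TriangularGWA.u _, by simpa [limitHom] using SpecializesTo.U⟩
    · exact ⟨TriangularGWA.d _, by simpa [limitHom] using SpecializesTo.D⟩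
    · exact ⟨1, by simpa using SpecializesTo.coeff_T_one⟩
    · exact ⟨1, by simpa using SpecializesTo.coeff_T_neg_one⟩
    · refine ⟨(-γ / l)⁻¹ • TriangularGWA.coeff _ Polynomial.X, ?_⟩
      have h0 : -γ / (l : F) ≠ 0 := div_ne_zero (neg_ne_zero.mpr hγ) hl
      rw [map_smul, limitHom, TriangularGWA.lift_coeff, Polynomial.aeval_X, limitH,
        inv_smul_smul₀ h0]
      exact SpecializesTo.coeff_quantumK0
  | algebraMap r => exact ⟨algebraMap F _ (evalOne r), by
      rw [AlgHom.commutes]; exact SpecializesTo.scalar r⟩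
  | add x y _ _ hx hy =>
    obtain ⟨x', hx⟩ := hx
    obtain ⟨y', hy⟩ := hy
    exact ⟨x' + y', by simpa using hx.add hy⟩
  | mul x y _ _ hx hy =>
    obtain ⟨x', hx⟩ := hx
    obtain ⟨y', hy⟩ := hy
    exact ⟨x' * y', by simpa using hx.mul hy⟩

/-- Provides an explicit lift to `𝓦_q` of the image of an ordered expression, to which the quantum
ladder representation can be applied. -/
theorem specializesTo_ordered (hl : (l : F) ≠ 0) (P : ℕ × ℕ →₀ F[X]) : SpecializesTo
    (TriangularGWA.ordered (quantumData γ s f l m n)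
      (P.mapRange (Polynomial.aeval (quantumH F γ l)) (map_zero _)))
    (limitHom γ s f l m n hl (TriangularGWA.ordered (downUpData γ s f) P)) := by
  induction P using Finsupp.induction_linear with
  | zero => simpa using SpecializesTo.zero
  | add P Q hP hQ =>
    rw [Finsupp.mapRange_add (fun _ _ => map_add _ _ _), map_add, map_add, map_add]
    exact hP.add hQ
  | single p h =>
    rw [Finsupp.mapRange_single, TriangularGWA.ordered_single, TriangularGWA.ordered_single]
    simp only [map_mul, map_pow, limitHom, TriangularGWA.lift_coeff, TriangularGWA.lift_d,
      TriangularGWA.lift_u]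
    exact (SpecializesTo.D.pow _).mul
      ((specializesTo_quantumH.coeff_aeval h).mul (SpecializesTo.U.pow _))

/-! ### Lattices over `R` and injectivity of the comparison. -/

/-- The `R`-form preserves the `R`-span of a family of weight vectors whose weights specialize at
`q = 1`, as soon as `U` and `D` do. -/
theorem map_mem_span_of_mem_rSubalgebra {N : Type*} {ι : Type*} [AddCommGroup N]
    [Module (RatFunc F) N] (ρ : QuantumGWA γ s f l m n →ₐ[RatFunc F] Module.End (RatFunc F) N)
    {b : ι → N} {x : ι → (RatFunc F)ˣ} {c : ι → F} (hx : ∀ i, Deforms (x i) (c i))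
    (hb : ∀ i h, ρ (coeff γ s f l m n h) (b i) = laurentLift (x i) h • b i)
    (hU : ∀ i, ρ (U γ s f l m n) (b i) ∈ Submodule.span (regularAtOne F) (Set.range b))
    (hD : ∀ i, ρ (D γ s f l m n) (b i) ∈ Submodule.span (regularAtOne F) (Set.range b))
    {a : QuantumGWA γ s f l m n} (ha : a ∈ rSubalgebra γ s f l m n) :
    ∀ y ∈ Submodule.span (regularAtOne F) (Set.range b),
      ρ a y ∈ Submodule.span (regularAtOne F) (Set.range b) := by
  set L := Submodule.span (regularAtOne F) (Set.range b)
  have mem : ∀ i, b i ∈ L := fun i => Submodule.subset_span ⟨i, rfl⟩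
  have key : ∀ φ : Module.End (RatFunc F) N, (∀ i, φ (b i) ∈ L) → ∀ y ∈ L, φ y ∈ L := by
    intro φ hφ y hy
    induction hy using Submodule.span_induction with
    | mem y hy => obtain ⟨i, rfl⟩ := hy; exact hφ i
    | zero => rw [map_zero]; exact L.zero_mem
    | add y z _ _ hy hz => rw [map_add]; exact L.add_mem hy hz
    | smul r y _ hy =>
      have : φ (r • y) = r • φ y := map_smul φ (r : RatFunc F) y
      rw [this]; exact L.smul_mem r hy
  have keyR : ∀ g, (∀ i, ∃ r : regularAtOne F, laurentLift (x i) g = (r : RatFunc F)) →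
      ∀ y ∈ L, ρ (coeff γ s f l m n g) y ∈ L := by
    intro g hg
    refine key _ fun i => ?_
    obtain ⟨r, hr⟩ := hg i
    rw [hb, hr]
    exact L.smul_mem r (mem i)
  induction ha using Algebra.adjoin_induction with
  | mem a ha =>
    rcases ha with rfl | rfl | rfl | rfl | rfl
    · exact key _ hU
    · exact key _ hD
    · exact keyR _ fun i => ((hx i).laurentLift_T 1).imp fun _ h => h.1
    · exact keyR _ fun i => ((hx i).laurentLift_T (-1)).imp fun _ h => h.1
    · exact keyR _ fun i => (hx i).laurentLift_quantumK0.imp fun _ h => h.1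
  | algebraMap r =>
    refine key _ fun i => ?_
    have : ρ (algebraMap (regularAtOne F) (QuantumGWA γ s f l m n) r) (b i) = r • b i :=
      congrArg (fun φ : Module.End (RatFunc F) N => φ (b i)) (ρ.commutes (r : RatFunc F))
    rw [this]
    exact L.smul_mem r (mem i)
  | add a a' _ _ h h' =>
    intro y hy
    rw [map_add]
    exact L.add_mem (h y hy) (h' y hy)
  | mul a a' _ _ h h' =>
    intro y hy
    rw [map_mul]
    exact h _ (h' y hy)

open TriangularGWA in
-- The structure constants of the ladder are built from values of `z₀` and `z₁` at the weights `K ↦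
-- q⁻ˡʲ x`, which lie in `R`. So the `R`-span of the basis is stable under the `R`-form.
theorem ladder_apply_mem {x : (RatFunc F)ˣ} {c : F} (hx : Deforms x c)
    {a : QuantumGWA γ s f l m n} (ha : a ∈ rSubalgebra γ s f l m n) (p : ℕ × ℕ) :
    ladder (quantumData γ s f l m n) (shiftedWeight_add_one x) a (Finsupp.single (0, 0) 1) p ∈
      regularAtOne F := by
  let 𝒟 := quantumData γ s f l m n
  have hR : ∀ i k, ladderRaise 𝒟 (shiftedWeight l x) i k ∈ regularAtOne F := by
    intro i k
    induction i with
    | zero => exact one_mem _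
    | succ i ih => exact mul_mem (laurentLift_z₁_mem _) ih
  have hL : ∀ i k, ladderLower 𝒟 (shiftedWeight l x) i k ∈ regularAtOne F := by
    intro i k
    induction i with
    | zero => exact zero_mem _
    | succ i ih => exact add_mem (hx.shift _).laurentLift_z₀ (mul_mem (laurentLift_z₁_mem _) ih)
  let b : ℕ × ℕ → (ℕ × ℕ →₀ RatFunc F) := fun p => Finsupp.single p 1
  have mem : ∀ i, b i ∈ Submodule.span (regularAtOne F) (Set.range b) := fun i =>
    Submodule.subset_span ⟨i, rfl⟩
  have h := map_mem_span_of_mem_rSubalgebra (ladder 𝒟 (shiftedWeight_add_one x)) (b := b)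
    (fun p => hx.shift (p.1 - p.2)) (fun p h => by
      rw [coeff, ladder, lift_coeff]; exact ladderCoeff_single _ _ _ _)
    (fun p => by
      rw [U, ladder, lift_u, ladderU_single]
      exact add_mem (Submodule.smul_mem _ (⟨_, hR _ _⟩ : regularAtOne F) (mem _))
        (Submodule.smul_mem _ (⟨_, hL _ _⟩ : regularAtOne F) (mem _)))
    (fun p => by
      rw [D, ladder, lift_d, ladderD_single]; exact mem _) ha (b (0, 0)) (mem _)
  have hle : ∀ y ∈ Submodule.span (regularAtOne F) (Set.range b), ∀ p, y p ∈ regularAtOne F := by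
    intro y hy p
    induction hy using Submodule.span_induction with
    | mem y hy =>
      obtain ⟨i, rfl⟩ := hy
      classical
      simp only [b, Finsupp.single_apply]
      split_ifs
      · exact one_mem _
      · exact zero_mem _
    | zero => exact zero_mem _
    | add y z _ _ hy hz => exact add_mem hy hz
    | smul r y _ hy => exact mul_mem r.2 hy
  exact hle _ h p

theorem limitHom_injective [CharZero F] (hγ : γ ≠ 0) (hl : (l : F) ≠ 0) :
    Function.Injective (limitHom γ s f l m n hl) := by
  rw [injective_iff_map_eq_zero]
  intro w hw
  obtain ⟨P, rfl⟩ := TriangularGWA.ordered_surjective _ w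
  obtain ⟨y, hy, hy0⟩ := specializesTo_ordered (s := s) (f := f) (m := m) (n := n) hl P
  rw [hw, toLimit_eq_zero_iff] at hy0
  obtain ⟨z, rfl⟩ := hy0
  suffices hP : P = 0 by rw [hP, map_zero]
  ext1 p
  refine Polynomial.funext fun a => ?_
  have h0 : -γ / (l : F) ≠ 0 := div_ne_zero (neg_ne_zero.mpr hγ) hl
  -- The base weight is chosen so that, after the shift by `-p.2` in `ladder_ordered_apply`, the
  -- element specializing to `h` takes the value `a` at `q = 1`.
  obtain ⟨x, hx⟩ := Deforms.exists_deforms (a / (-γ / l) - l * p.2)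
  have h1 := congrArg (fun w => TriangularGWA.ladder (quantumData γ s f l m n)
    (shiftedWeight_add_one x) w (Finsupp.single (0, 0) 1) p) hy
  simp only [TriangularGWA.ladder_ordered_apply, Finsupp.mapRange_apply] at h1
  obtain ⟨r, hr, hr1⟩ := (hx.shift (-p.2)).laurentLift_aeval (-γ / l) (P p)
  rw [shiftedWeight, quantumH, hr] at h1
  have h2 : r = qSubOne F * ⟨_, ladder_apply_mem hx z.2 p⟩ := by
    refine Subtype.ext (h1.symm.trans ?_)
    rw [map_mul, map_mul]
    have : TriangularGWA.ladder (quantumData γ s f l m n) (shiftedWeight_add_one x)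
        (RForm.incl γ s f l m n (algebraMap (regularAtOne F) _ (qSubOne F))) =
        algebraMap (RatFunc F) _ (RatFunc.X - 1) := AlgHom.commutes _ _
    rw [this]
    rfl
  have h3 : evalOne r = 0 := by rw [h2, map_mul, evalOne_qSubOne, zero_mul]
  rw [hr1] at h3
  have h4 : -γ / (l : F) * (a / (-γ / l) - l * p.2 - l * ((-p.2 : ℤ) : F)) = a := by
    push_cast
    field_simp
    ring
  rw [h4] at h3
  simpa using h3

variable (γ s f l m n) in
/-- The isomorphism from the generalized down-up algebra to the classical limit. -/
noncomputable def limitEquiv [CharZero F] (hγ : γ ≠ 0) (hl : (l : F) ≠ 0) :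
    DownUpAlgebra γ s f ≃ₐ[F] ClassicalLimit γ s f l m n :=
  AlgEquiv.ofBijective (limitHom γ s f l m n hl)
    ⟨limitHom_injective hγ hl, limitHom_surjective hγ hl⟩

end QuantumGWA

/-! ### The classical limit of a highest weight module -/

namespace QuantumGWA

variable {F : Type u} [Field F] {γ s : F} {f : F[X]} {l m n : ℤ}

section ModuleLimit

variable {V : Type w} [AddCommGroup V] [Module (QuantumGWA γ s f l m n) V] (v : V)

variable (γ s f l m n) in
/-- The class of the generator `v` in the classical limit. -/
noncomputable def limitVector : ModuleLimit γ s f l m n v :=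
  Submodule.Quotient.mk (p := moduleLimitSub γ s f l m n v)
    ⟨v, Submodule.mem_span_singleton_self _⟩

theorem toLimit_smul_limitVector (y : RForm γ s f l m n) :
    toLimit γ s f l m n y • limitVector γ s f l m n v =
      Submodule.Quotient.mk (p := moduleLimitSub γ s f l m n v)
        (y • ⟨v, Submodule.mem_span_singleton_self _⟩) :=
  rfl

theorem exists_toLimit_smul_limitVector (x : ModuleLimit γ s f l m n v) :
    ∃ y, x = toLimit γ s f l m n y • limitVector γ s f l m n v := by
  obtain ⟨⟨x, hx⟩, rfl⟩ := Submodule.Quotient.mk_surjective (moduleLimitSub γ s f l m n v) x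
  obtain ⟨y, rfl⟩ := Submodule.mem_span_singleton.mp hx
  exact ⟨y, rfl⟩

variable {v}

/-- As `q - 1` is central and the module is cyclic, a sum of products from `limitIdeal • ⊤`
collapses to a single term. -/
theorem mem_moduleLimitSub {x : moduleRForm γ s f l m n v}
    (hx : x ∈ moduleLimitSub γ s f l m n v) : ∃ z : RForm γ s f l m n,
      (x.1 : V) = algebraMap (RatFunc F) (QuantumGWA γ s f l m n) (RatFunc.X - 1) •
        RForm.incl γ s f l m n z • v := by
  induction hx using Submodule.smul_induction_on' with
  | smul r hr x _ =>
    obtain ⟨w, rfl⟩ := Ideal.mem_span_singleton'.mp hr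
    obtain ⟨x, hx⟩ := x
    obtain ⟨y, rfl⟩ := Submodule.mem_span_singleton.mp hx
    refine ⟨w * y, ?_⟩
    rw [← Algebra.commutes, map_mul, smul_smul]
    change (_ * RForm.incl γ s f l m n w) • (RForm.incl γ s f l m n y) • v = _
    rw [smul_smul, mul_assoc]
    rfl
  | add x _ y _ hx hy =>
    obtain ⟨z, hz⟩ := hx
    obtain ⟨z', hz'⟩ := hy
    refine ⟨z + z', ?_⟩
    rw [map_add, add_smul, smul_add, ← hz, ← hz']
    rfl

theorem toLimit_smul_limitVector_congr {y z : RForm γ s f l m n}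
    (h : RForm.incl γ s f l m n y • v = RForm.incl γ s f l m n z • v) :
    toLimit γ s f l m n y • limitVector γ s f l m n v =
      toLimit γ s f l m n z • limitVector γ s f l m n v := by
  rw [toLimit_smul_limitVector, toLimit_smul_limitVector]
  exact congrArg _ (Subtype.ext h)

theorem exists_of_toLimit_smul_limitVector_eq_zero {y : RForm γ s f l m n}
    (h : toLimit γ s f l m n y • limitVector γ s f l m n v = 0) : ∃ z : RForm γ s f l m n,
      RForm.incl γ s f l m n y • v = algebraMap (RatFunc F) (QuantumGWA γ s f l m n)
        (RatFunc.X - 1) • RForm.incl γ s f l m n z • v := by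
  rw [toLimit_smul_limitVector] at h
  exact mem_moduleLimitSub ((Submodule.Quotient.mk_eq_zero _).mp h)

variable {x : (RatFunc F)ˣ} {c : F}

theorem lowerCoeff_mem (hx : Deforms x c) (k : ℕ) :
    TriangularGWA.lowerCoeff (quantumData γ s f l m n) (laurentLift x) k ∈ regularAtOne F := by
  induction k with
  | zero => exact hx.laurentLift_z₀
  | succ k ih =>
    rw [TriangularGWA.lowerCoeff, laurentLift_θ_pow_apply, laurentLift_θ_pow_apply]
    exact add_mem (hx.shift _).laurentLift_z₀ (mul_mem (laurentLift_z₁_mem _) ih)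

/-- The weights of a highest weight module over `𝓦_q` are pairwise distinct. -/
theorem injective_weight [CharZero F] (hl : (l : F) ≠ 0) (hx : Deforms x c) :
    Function.Injective fun k : ℕ => (laurentLift x : (RatFunc F)[T;T⁻¹] →ₐ[RatFunc F] RatFunc F)
      (((quantumData γ s f l m n).θ ^ k) (LaurentPolynomial.T 1)) := by
  intro j k hjk
  simp only [laurentLift_θ_pow_apply, shiftedWeight, laurentLift_T, zpow_one] at hjk
  have h1 := hx.shift (l := l) j
  rw [Units.ext hjk] at h1
  -- Equal weights have equal first-order terms `c - l j` and `c - l k`.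
  have h2 := h1.eq (hx.shift k)
  simpa [hl] using h2

/-- The weights of a highest weight module over the generalized down-up algebra are pairwise
distinct. -/
theorem injective_downUp_weight [CharZero F] (hγ : γ ≠ 0) (a : F) :
    Function.Injective fun k : ℕ => (Polynomial.aeval a : F[X] →ₐ[F] F)
      (((downUpData γ s f).θ ^ k) Polynomial.X) := by
  intro j k hjk
  simpa [downUp_θ_pow_X, hγ] using hjk

open TriangularGWA in
/-- The `R`-form of a highest weight module is spanned over `R` by the vectors `Dᵏ v`. -/
theorem exists_incl_smul_eq_sum (hx : Deforms x c)
    (hv : IsWeightVector (quantumData γ s f l m n) (laurentLift x) v)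
    (hU : U γ s f l m n • v = 0) (z : RForm γ s f l m n) : ∃ P : ℕ →₀ regularAtOne F,
      RForm.incl γ s f l m n z • v = P.sum fun k r =>
        algebraMap (RatFunc F) (QuantumGWA γ s f l m n) r • D γ s f l m n ^ k • v := by
  let _ : Module (RatFunc F) V :=
    Module.compHom V (algebraMap (RatFunc F) (QuantumGWA γ s f l m n))
  have _ : IsScalarTower (RatFunc F) (QuantumGWA γ s f l m n) V := ⟨fun c a y => by
    rw [Algebra.smul_def, mul_smul]; rfl⟩
  let b : ℕ → V := fun k => D γ s f l m n ^ k • v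
  have mem : ∀ i, b i ∈ Submodule.span (regularAtOne F) (Set.range b) := fun i =>
    Submodule.subset_span ⟨i, rfl⟩
  have h := map_mem_span_of_mem_rSubalgebra
    (Algebra.lsmul (RatFunc F) (RatFunc F) V : QuantumGWA γ s f l m n →ₐ[RatFunc F] _) (b := b)
    (fun k => hx.shift k) (fun k h => by
      refine (hv.d_pow_smul k h).trans ?_
      rw [laurentLift_comp_θ_pow]
      rfl)
    (fun k => by
      rcases k with _ | k
      · have h0 : U γ s f l m n • b 0 = 0 := by simpa [b] using hU
        change U γ s f l m n • b 0 ∈ _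
        rw [h0]
        exact zero_mem _
      · rw [Algebra.lsmul_coe]
        simp only [b]
        rw [u_smul_d_pow_smul hv hU]
        exact Submodule.smul_mem _ (⟨_, lowerCoeff_mem hx k⟩ : regularAtOne F) (mem k))
    (fun k => by
      have h1 : D γ s f l m n • b k = b (k + 1) := by rw [smul_smul, ← pow_succ']
      change D γ s f l m n • b k ∈ _
      rw [h1]
      exact mem _) z.2 (b 0) (mem 0)
  obtain ⟨P, hP⟩ := Finsupp.mem_span_range_iff_exists_finsupp.mp h
  refine ⟨P, ?_⟩
  have h0 : b 0 = v := by simp [b]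
  rw [h0] at hP
  exact hP.symm

open TriangularGWA in
-- No nonzero `Dᵏ v` lies in `q - 1` times the lattice: the weight decomposition isolates the `k`-th
-- component, and `1 - (q - 1) r` is nonzero for `r` in `R`.
theorem d_pow_smul_limitVector_eq_zero_iff [CharZero F] (hl : (l : F) ≠ 0) (hx : Deforms x c)
    (hv : IsWeightVector (quantumData γ s f l m n) (laurentLift x) v)
    (hU : U γ s f l m n • v = 0) (k : ℕ) :
    toLimit γ s f l m n (rD γ s f l m n ^ k) • limitVector γ s f l m n v = 0 ↔
      D γ s f l m n ^ k • v = 0 := by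
  have hD : RForm.incl γ s f l m n (rD γ s f l m n ^ k) = D γ s f l m n ^ k := map_pow _ _ _
  constructor
  · intro h
    obtain ⟨z, hz⟩ := exists_of_toLimit_smul_limitVector_eq_zero h
    obtain ⟨P, hP⟩ := exists_incl_smul_eq_sum hx hv hU z
    rw [hD, hP] at hz
    let _ : Module (RatFunc F) V :=
      Module.compHom V (algebraMap (RatFunc F) (QuantumGWA γ s f l m n))
    have _ : IsScalarTower (RatFunc F) (QuantumGWA γ s f l m n) V := ⟨fun c a y => by
      rw [Algebra.smul_def, mul_smul]; rfl⟩
    let Q : ℕ →₀ RatFunc F := Finsupp.single k 1 -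
      (RatFunc.X - 1 : RatFunc F) • P.mapRange Subtype.val rfl
    have hQ : (Q.sum fun k c => c • D γ s f l m n ^ k • v) = 0 := by
      have e : ∀ Q : ℕ →₀ RatFunc F, (Q.sum fun k c => c • D γ s f l m n ^ k • v) =
          Finsupp.linearCombination (RatFunc F) (fun k => D γ s f l m n ^ k • v) Q := fun _ => rfl
      rw [e, map_sub, map_smul, Finsupp.linearCombination_single, one_smul, hz, ← e,
        Finsupp.sum_mapRange_index (by simp)]
      exact sub_self _
    have h1 := smul_d_pow_smul_eq_zero hv (injective_weight hl hx) hQ k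
    refine (smul_eq_zero.mp h1).resolve_left fun h2 => ?_
    -- Evaluating at `q = 1` would give `1 = 0`.
    have h3 : (1 : regularAtOne F) = qSubOne F * P k := by
      refine Subtype.ext ?_
      have h4 : Q k = 1 - (RatFunc.X - 1) * (P k : RatFunc F) := by simp [Q]
      exact sub_eq_zero.mp (h4.symm.trans h2)
    simpa using congrArg evalOne h3
  · intro h
    have h1 : RForm.incl γ s f l m n (rD γ s f l m n ^ k) • v =
        RForm.incl γ s f l m n 0 • v := by rw [hD, h, map_zero, zero_smul]
    rw [toLimit_smul_limitVector_congr h1, map_zero, zero_smul]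

open TriangularGWA in
theorem aeval_limitH_smul_limitVector (hx : Deforms x c)
    (hv : IsWeightVector (quantumData γ s f l m n) (laurentLift x) v) (p : F[X]) :
    Polynomial.aeval (limitH γ s f l m n) p • limitVector γ s f l m n v =
      algebraMap F (ClassicalLimit γ s f l m n) (p.eval (-γ / (l : F) * c)) •
        limitVector γ s f l m n v := by
  obtain ⟨y, hy, hy'⟩ := (specializesTo_quantumH (γ := γ) (s := s) (f := f) (l := l) (m := m)
    (n := n)).coeff_aeval p
  obtain ⟨r, hr, hr1⟩ := hx.laurentLift_aeval (-γ / l) p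
  rw [← hy', ← hr1, ← toLimit_algebraMap]
  refine toLimit_smul_limitVector_congr ?_
  rw [hy]
  refine (hv _).trans ?_
  rw [quantumH, hr]
  rfl

end ModuleLimit

end QuantumGWA

open TriangularGWA QuantumGWA in
theorem mainTheorem11 {F : Type u} [Field F] [CharZero F] (γ s : F) (hγ : γ ≠ 0)
    (hs : s ≠ 0) (hs_root : ∀ k : ℕ, 0 < k → s ^ k ≠ 1) (f : Polynomial F)
    (l m n : ℤ) (hl : l ≠ 0) :
    ∃ e : DownUpAlgebra γ s f ≃ₐ[F] QuantumGWA.ClassicalLimit γ s f l m n,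
      e (TriangularGWA.u (downUpData γ s f)) =
        QuantumGWA.toLimit γ s f l m n (QuantumGWA.rU γ s f l m n) ∧
      e (TriangularGWA.d (downUpData γ s f)) =
        QuantumGWA.toLimit γ s f l m n (QuantumGWA.rD γ s f l m n) ∧
      e (TriangularGWA.coeff (downUpData γ s f) Polynomial.X) =
        (-γ / (l : F)) • QuantumGWA.toLimit γ s f l m n (QuantumGWA.rK0 γ s f l m n) ∧
      ∀ lam : (RatFunc F)ˣ,
        ((lam : RatFunc F) - 1) / (RatFunc.X - 1) ∈ regularAtOne F →
        ∀ (V : Type w) [AddCommGroup V] [Module (QuantumGWA γ s f l m n) V],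
          TriangularGWA.IsHighestWeightModule (quantumData γ s f l m n) (laurentLift lam) V →
          ∀ v : V, TriangularGWA.IsWeightVector (quantumData γ s f l m n) (laurentLift lam) v →
            Submodule.span (QuantumGWA γ s f l m n) {v} = ⊤ →
            TriangularGWA.IsHighestWeightModule (downUpData γ s f)
              (Polynomial.aeval (-γ / (l : F) * RatFunc.eval (RingHom.id F) 1
                (((lam : RatFunc F) - 1) / (RatFunc.X - 1))))
              (PullbackModule (e : DownUpAlgebra γ s f →+*
                QuantumGWA.ClassicalLimit γ s f l m n) (QuantumGWA.ModuleLimit γ s f l m n v)) ∧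
            TriangularGWA.SameGradedCharacter (downUpData γ s f) (quantumData γ s f l m n)
              (Polynomial.aeval (-γ / (l : F) * RatFunc.eval (RingHom.id F) 1
                (((lam : RatFunc F) - 1) / (RatFunc.X - 1))))
              (PullbackModule (e : DownUpAlgebra γ s f →+*
                QuantumGWA.ClassicalLimit γ s f l m n) (QuantumGWA.ModuleLimit γ s f l m n v))
              (laurentLift lam) V := by
  have hlF : (l : F) ≠ 0 := Int.cast_ne_zero.mpr hl
  have he_u : limitEquiv γ s f l m n hγ hlF (TriangularGWA.u _) =
      toLimit γ s f l m n (rU γ s f l m n) := lift_u _ _ _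
  have he_d : limitEquiv γ s f l m n hγ hlF (TriangularGWA.d _) =
      toLimit γ s f l m n (rD γ s f l m n) := lift_d _ _ _
  have he_c (p) : limitEquiv γ s f l m n hγ hlF (TriangularGWA.coeff _ p) =
      Polynomial.aeval (limitH γ s f l m n) p := lift_coeff _ _ _ p
  refine ⟨limitEquiv γ s f l m n hγ hlF, he_u, he_d,
    (he_c _).trans (Polynomial.aeval_X _), ?_⟩
  intro lam hlam V _ _ hV v hv hgen
  set c := RatFunc.eval (RingHom.id F) 1 (((lam : RatFunc F) - 1) / (RatFunc.X - 1)) with hc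
  have hdef : Deforms lam c := ⟨⟨_, hlam⟩, by
    rw [div_mul_cancel₀ _ ratFunc_X_sub_one_ne_zero, add_sub_cancel], rfl⟩
  have hU : QuantumGWA.U γ s f l m n • v = 0 :=
    hV.u_smul_eq_zero (injective_weight hlF hdef) hv
  have hv0 : v ≠ 0 := by
    rintro rfl
    obtain ⟨x, hx⟩ := @exists_ne V hV.1 0
    rw [Submodule.span_zero_singleton] at hgen
    exact hx ((Submodule.mem_bot _).mp (hgen ▸ Submodule.mem_top))
  let e : DownUpAlgebra γ s f →+* ClassicalLimit γ s f l m n := limitEquiv γ s f l m n hγ hlF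
  let v₁ : PullbackModule e (ModuleLimit γ s f l m n v) := limitVector γ s f l m n v
  have hsmul (a : DownUpAlgebra γ s f) : a • v₁ =
      (limitEquiv γ s f l m n hγ hlF a • limitVector γ s f l m n v :
        ModuleLimit γ s f l m n v) := rfl
  have hv₁ : IsWeightVector (downUpData γ s f)
      (Polynomial.aeval (-γ / (l : F) * c)) v₁ := fun p => by
    rw [hsmul, hsmul, he_c, AlgEquiv.commutes, Polynomial.coe_aeval_eq_eval]
    exact aeval_limitH_smul_limitVector hdef hv p
  have hU₁ : TriangularGWA.u (downUpData γ s f) • v₁ = 0 := by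
    have h1 : RForm.incl γ s f l m n (rU γ s f l m n) • v =
        RForm.incl γ s f l m n 0 • v := by
      rw [map_zero, zero_smul]; exact hU
    rw [hsmul, he_u, toLimit_smul_limitVector_congr h1, map_zero, zero_smul]
    rfl
  have hgen₁ : Submodule.span (DownUpAlgebra γ s f) {v₁} = ⊤ := eq_top_iff.mpr fun x _ => by
    obtain ⟨y, hy⟩ := exists_toLimit_smul_limitVector v x
    obtain ⟨a, ha⟩ := (limitEquiv γ s f l m n hγ hlF).surjective (toLimit γ s f l m n y)
    refine Submodule.mem_span_singleton.mpr ⟨a, ?_⟩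
    rw [hsmul, ha]
    exact hy.symm
  have hd (k : ℕ) : TriangularGWA.d (downUpData γ s f) ^ k • v₁ = 0 ↔
      TriangularGWA.d (quantumData γ s f l m n) ^ k • v = 0 := by
    rw [hsmul, map_pow, he_d, ← map_pow]
    exact d_pow_smul_limitVector_eq_zero_iff hlF hdef hv hU k
  -- The case `k = 0` of the comparison shows that the limit module is nonzero.
  have hv₁0 : v₁ ≠ 0 := fun h => hv0 (by simpa using (hd 0).mp (by simpa using h))
  have hinj := injective_weight (γ := γ) (s := s) (f := f) (m := m) (n := n) hlF hdef
  have hinj₁ := injective_downUp_weight (s := s) (f := f) hγ (-γ / (l : F) * c)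
  refine ⟨isHighestWeightModule_of_generator hv₁ hU₁ hgen₁ hv₁0, fun k => ?_, fun ν hν => ?_,
    fun ν hν => ?_⟩
  · classical
    rw [formalCharacter_comp_pow hv hU hgen hinj k]
    refine (formalCharacter_comp_pow hv₁ hU₁ hgen₁ hinj₁ k).trans ?_
    simp only [hd]
  · exact exists_eq_of_formalCharacter_ne_zero hv₁ hU₁ hgen₁ hinj₁ hν
  · exact exists_eq_of_formalCharacter_ne_zero hv hU hgen hinj hν
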